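/- Conventions. A finite field extension $F/k$ is \emph{Hopf Galois} if there are a finite-dimensional cocommutative $k$-Hopf algebra $H$ and an $H$-module algebra structure on $F$ such that the $k$-linear map $j:F\otimes_k H\to\operatorname{End}_k(F)$, $j(s\otimes h)(t)=s\cdot h(t)$, is bijective. If $L$ is the Galois closure of $F/k$ and $N$ is a finite group, such a structure is said to be \emph{of type $N$} if $L\otimes_k H\cong L[N]$ as Hopf algebras over $L$. Put $G=\operatorname{Gal}(L/k)$, $G'=\operatorname{Gal}(L/F)$, and let $\lambda:G\to\operatorname{Sym}(G/G')$ be the action of $G$ on left cosets by left translation. A separable extension $F/k$ is \emph{almost classically Galois} if there is a regular (that is, simply transitive) subgroup of $\operatorname{Sym}(G/G')$ that is normalized by $\lambda(G)$ and contained in $\lambda(G)$. Let $F_{36}=(C_3\times C_3)\rtimes C_4$, where a generator of $C_4$ acts by $(x,y)\mapsto(-y,x)$; this is the abstract group underlying the transitive permutation group $6T10$. Proposition. Let $K/k$ be a separable field extension of degree $6$ with Galois closure $\tilde K/k$, assume that $\operatorname{Gal}(\tilde K/k)\cong F_{36}$, and let $F$ be a field with $K\subseteq F\subseteq\tilde K$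 (so that $\tilde K$ is also the Galois closure of $F/k$). 1. If $[F:k]=12$, then $F/k$ is not Hopf Galois. 2. If $[F:k]=18$, then $F/k$ is Hopf Galois, and more precisely it has a Hopf Galois structure of type $N=\mathtt{SmallGroup}(18,4)=(C_3\times C_3)\rtimes C_2$, where $C_2$ acts by inversion; but $F/k$ is not almost classically Galois. -/

import Mathlib

open scoped TensorProduct

universe u v w

namespace HopfGalois

/-! ### Hopf Galois extensions -/

section HopfGaloisDefs

variable (k : Type u) (F : Type v) [Field k] [Field F] [Algebra k F]
variable (H : Type w) [Ring H] [HopfAlgebra k H]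

/-- The linear action of `H` on `F` given by the algebra map `μ : H → End_k(F)` makes `F` into an
`H`-module algebra: `h (s t) = ∑ h₍₁₎(s) h₍₂₎(t)` and `h(1) = ε(h) 1`. -/
def IsModuleAlgebra (μ : H →ₐ[k] Module.End k F) : Prop :=
  (∀ (h : H) (s t : F),
    μ h (s * t) =
      LinearMap.mul' k F
        (TensorProduct.map (μ.toLinearMap.flip s) (μ.toLinearMap.flip t)
          (Coalgebra.comul (R := k) h))) ∧
  (∀ h : H, μ h 1 = algebraMap k F (Coalgebra.counit (R := k) h))

/-- The `k`-linear map `j : F ⊗_k H → End_k(F)`, `j(s ⊗ h)(t) = s · h(t)`. -/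
noncomputable def galoisMap (μ : H →ₐ[k] Module.End k F) : F ⊗[k] H →ₗ[k] Module.End k F :=
  TensorProduct.lift
    ((LinearMap.mul k (Module.End k F)).compl₁₂ (LinearMap.mul k F) μ.toLinearMap)

/-- The action `μ` of the finite cocommutative `k`-Hopf algebra `H` on `F` is a
Hopf Galois structure on `F/k`. -/
def IsHopfGaloisAction (μ : H →ₐ[k] Module.End k F) : Prop :=
  Module.Finite k H ∧ Coalgebra.IsCocomm k H ∧
    IsModuleAlgebra k F H μ ∧ Function.Bijective (galoisMap k F H μ)

end HopfGaloisDefs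

/-- `F/k` is a Hopf Galois extension: it is finite, and some finite cocommutative `k`-Hopf algebra
`H` acts on `F` by a Hopf Galois structure. (A finite-dimensional `k`-space is in bijection with
some `Fin n → k`, and `k` embeds into `F`, so letting `H` range over the universe of `F` is no
restriction.) -/
def IsHopfGalois (k : Type u) (F : Type v) [Field k] [Field F] [Algebra k F] : Prop :=
  FiniteDimensional k F ∧
  ∃ (H : Type v) (_ : Ring H) (_ : HopfAlgebra k H) (μ : H →ₐ[k] Module.End k F),
    IsHopfGaloisAction k F H μ

/-- The extension `F/k` has a Hopf Galois structure of type `N`, where `L` is the Galois closure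
of `F/k`: one whose Hopf algebra `H` satisfies `L ⊗_k H ≃ L[N]` as Hopf algebras over `L`
(i.e. `H` is an `L`-form of the group algebra of `N`). A morphism of bialgebras between Hopf
algebras automatically commutes with the antipodes. -/
def HasHopfGaloisStructureOfType (k : Type u) (F L : Type v) [Field k] [Field F] [Field L]
    [Algebra k F] [Algebra k L] (N : Type w) [Group N] : Prop :=
  FiniteDimensional k F ∧
  ∃ (H : Type v) (_ : Ring H) (_ : HopfAlgebra k H) (μ : H →ₐ[k] Module.End k F),
    IsHopfGaloisAction k F H μ ∧ Nonempty ((L ⊗[k] H) ≃ₐc[L] MonoidAlgebra L N)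

/-! ### Almost classically Galois extensions -/

/-- A subgroup `N` of `Sym(X)` is regular: it acts simply transitively on `X`. -/
def IsRegularSubgroup {X : Type w} (N : Subgroup (Equiv.Perm X)) : Prop :=
  ∀ x y : X, ∃! n : Equiv.Perm X, n ∈ N ∧ n x = y

/-- Let `L/k` be the Galois closure of `F/k`, `G = Gal(L/k)` and `G' = Gal(L/F)`. The extension
`F/k` is almost classically Galois if there is a regular subgroup `N` of `Sym(G/G')`
that is normalized by `λ(G)` and contained in `λ(G)`, where `λ : G → Sym(G/G')` is the action by
left translations on the left cosets. -/
def IsAlmostClassicallyGalois {k : Type u} {L : Type v} [Field k] [Field L] [Algebra k L]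
    (F : IntermediateField k L) : Prop :=
  ∃ N : Subgroup (Equiv.Perm ((L ≃ₐ[k] L) ⧸ F.fixingSubgroup)),
    IsRegularSubgroup N ∧
    (MulAction.toPermHom (L ≃ₐ[k] L) ((L ≃ₐ[k] L) ⧸ F.fixingSubgroup)).range ≤
      Subgroup.normalizer (N : Set (Equiv.Perm ((L ≃ₐ[k] L) ⧸ F.fixingSubgroup))) ∧
    N ≤ (MulAction.toPermHom (L ≃ₐ[k] L) ((L ≃ₐ[k] L) ⧸ F.fixingSubgroup)).range

/-! ### The two finite groups -/

/-- The elementary abelian group `C₃ × C₃`, written multiplicatively. -/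
abbrev C3xC3 : Type := Multiplicative (ZMod 3 × ZMod 3)

/-- The automorphism `(x, y) ↦ (-y, x)` of `C₃ × C₃`, of order 4. -/
def quarterTurn : MulAut C3xC3 :=
  AddEquiv.toMultiplicative
    { toFun := fun p => (-p.2, p.1)
      invFun := fun p => (p.2, -p.1)
      left_inv := fun p => by simp
      right_inv := fun p => by simp
      map_add' := fun p q => by ext <;> simp [add_comm] }

/-- The automorphism `(x, y) ↦ (-x, -y)` of `C₃ × C₃`, of order 2. -/
def inversion : MulAut C3xC3 := MulEquiv.inv C3xC3

/-- `F₃₆ = (C₃ × C₃) ⋊ C₄`, with `C₄` generated by `(x, y) ↦ (-y, x)`: the Frobenius group of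
order 36 with complement `C₄`, i.e. the abstract group underlying the transitive permutation
group `6T10`. -/
abbrev F36 : Type :=
  C3xC3 ⋊[(Subgroup.zpowers quarterTurn).subtype] (Subgroup.zpowers quarterTurn)

/-- `SmallGroup(18,4) = (C₃ × C₃) ⋊ C₂`, with `C₂` acting by inversion: the generalized dihedral
group of `C₃ × C₃`. -/
abbrev SmallGroup18_4 : Type :=
  C3xC3 ⋊[(Subgroup.zpowers inversion).subtype] (Subgroup.zpowers inversion)

end HopfGalois

/-! Put G = Gal(L/k) and G' = Gal(L/F). The proof recasts Greither–Pareigis theory through crossed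
homomorphisms: Hopf Galois structures on F/k come from groups N with a G-action θ and a surjection f
: G → N satisfying f(γδ) = f(γ)·θ_γ(f(δ)) and f⁻¹(1) = G' (`IsCrossedParam`). Such an f identifies
G/G' with N.

From f to a structure (`hasHopfGaloisStructureOfType`): G acts semilinearly on L[N], and the
invariants H form a k-form of this Hopf algebra (`isHopfDescent_invariants`). The element f(γ) acts
on F as the embedding γ|_F. By the crossed identity, invariant elements map F into F and compose
correctly. From a structure to f (`exists_isCrossedParam_of_isHopfGalois`): L ⊗ H is identified with
Hom_k(F, L), and its group-like elements are exactly the embeddings of F. They form N, with G acting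
through the factor L and f(γ) corresponding to γ|_F.

Degree 12: G' has order 3 and is generated by a translation s in V = C₃ × C₃. It fixes 6 of the 12
cosets, hence 6 elements of N. The eight nontrivial elements of V form two conjugacy classes of size
4, so Burnside's lemma for V on N gives 9 ∣ 12 + 4·6 + 4x, where x is the number of fixed points for
the other class (or for the class of s again). Then 9 ∣ x. But x is the order of a subgroup of N, so
x ∣ 12, a contradiction.

Degree 18: G' is generated by a point reflection of the affine plane V, with centre u. Sending γ to
the element of V ⋊ {±1} that takes u to γ(u) and has linear part the square of that of γ gives,
after inversion, the required crossed homomorphism. A regular group inside λ(G) would have a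
preimage of index at most 2 in G. That preimage contains every square, in particular the reflection,
which fixes a coset but does not act trivially. -/

namespace HopfGalois

/-! ### Descent of Hopf algebras along a field extension -/

section Descent

variable {k : Type*} (L : Type*) {H A : Type*} [Field k] [Field L] [Algebra k L] [Ring A]
  [HopfAlgebra L A] [Algebra k A] [IsScalarTower k L A] [Ring H] [Algebra k H]

/-- The algebra map `H ⊗_k H → A ⊗_L A` induced by a `k`-algebra map `H → A`. -/
noncomputable def tensorSquareMap (i : H →ₐ[k] A) : H ⊗[k] H →ₐ[k] A ⊗[L] A :=
  (Algebra.TensorProduct.mapOfCompatibleSMul L k k A A).comp (Algebra.TensorProduct.map i i)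

@[simp]
lemma tensorSquareMap_tmul (i : H →ₐ[k] A) (x y : H) :
    tensorSquareMap L i (x ⊗ₜ y) = i x ⊗ₜ i y := rfl

/-- The linear map `H ⊗_k (H ⊗_k H) → A ⊗_L (A ⊗_L A)` induced by a `k`-algebra map `H → A`. -/
noncomputable def tensorCubeMap (i : H →ₐ[k] A) :
    H ⊗[k] (H ⊗[k] H) →ₗ[k] A ⊗[L] (A ⊗[L] A) :=
  (TensorProduct.mapOfCompatibleSMul L k k A (A ⊗[L] A)).comp
    (TensorProduct.map i.toLinearMap (tensorSquareMap L i).toLinearMap)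

@[simp]
lemma tensorCubeMap_tmul (i : H →ₐ[k] A) (x : H) (y : H ⊗[k] H) :
    tensorCubeMap L i (x ⊗ₜ y) = i x ⊗ₜ tensorSquareMap L i y := rfl

/-- The `k`-algebra map `i : H → A` to an `L`-Hopf algebra is an embedding of a `k`-form of `A`
which is closed under the Hopf algebra operations. -/
structure IsHopfDescent (i : H →ₐ[k] A) : Prop where
  linearIndependent : LinearIndependent L fun j => i (Module.Basis.ofVectorSpace k H j)
  span_range : Submodule.span L (Set.range i) = ⊤
  comul_mem : ∀ h, Coalgebra.comul (R := L) (i h) ∈ (tensorSquareMap L i).range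
  counit_mem : ∀ h, Coalgebra.counit (R := L) (i h) ∈ (Algebra.ofId k L).range
  antipode_mem : ∀ h, HopfAlgebra.antipode L (i h) ∈ LinearMap.range i.toLinearMap

/-- A `k`-linear map to an `L`-vector space which sends a `k`-basis to an `L`-linearly independent
family is injective. -/
lemma injective_of_basis {ι M P : Type*} [AddCommGroup M] [Module k M] [AddCommGroup P]
    [Module k P] [Module L P] [IsScalarTower k L P] (b : Module.Basis ι k M) (g : M →ₗ[k] P)
    (hg : LinearIndependent L fun j => g (b j)) : Function.Injective g := by
  have h1 : LinearIndependent k (fun j => g (b j)) :=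
    hg.restrict_scalars' k
  have h2 : LinearMap.ker g = ⊥ := by
    rw [LinearMap.ker_eq_bot']
    intro m hm
    have h3 : g m = Finsupp.linearCombination k (fun j => g (b j)) (b.repr m) := by
      conv_lhs => rw [← b.linearCombination_repr m]
      simp [Finsupp.linearCombination_apply, Finsupp.sum]
    rw [hm] at h3
    have h4 := (linearIndependent_iff.1 h1) (b.repr m) h3.symm
    simpa using h4
  exact LinearMap.ker_eq_bot.1 h2

namespace IsHopfDescent

variable {L} {i : H →ₐ[k] A} (hi : IsHopfDescent L i)

include hi

/-- The `L`-basis of `A` coming from a `k`-basis of the form `H`. -/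
noncomputable def basis : Module.Basis (Module.Basis.ofVectorSpaceIndex k H) L A :=
  Module.Basis.mk hi.linearIndependent (by
    rw [← hi.span_range, Submodule.span_le]
    rintro _ ⟨h, rfl⟩
    rw [← (Module.Basis.ofVectorSpace k H).linearCombination_repr h,
      Finsupp.linearCombination_apply, Finsupp.sum, map_sum]
    refine Submodule.sum_mem _ fun j _ => ?_
    rw [map_smul, ← algebraMap_smul L]
    exact Submodule.smul_mem _ _ (Submodule.subset_span ⟨j, rfl⟩))

@[simp]
lemma basis_apply (j) : hi.basis j = i (Module.Basis.ofVectorSpace k H j) := by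
  simp [basis]

lemma injective : Function.Injective i :=
  injective_of_basis L (Module.Basis.ofVectorSpace k H) i.toLinearMap hi.linearIndependent

/-- A product basis over k goes to a product basis over L. This injectivity and its analogue for
cubes let the coalgebra axioms of `H` be checked inside `A`. -/
lemma tensorSquareMap_injective : Function.Injective (tensorSquareMap L i) := by
  have hb := (hi.basis.tensorProduct hi.basis).linearIndependent
  refine injective_of_basis L ((Module.Basis.ofVectorSpace k H).tensorProduct
    (Module.Basis.ofVectorSpace k H)) (tensorSquareMap L i).toLinearMap ?_
  have h : (fun j => (tensorSquareMap L i).toLinearMap (((Module.Basis.ofVectorSpace k H).tensorProduct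
      (Module.Basis.ofVectorSpace k H)) j)) = hi.basis.tensorProduct hi.basis := by
    ext ⟨a, b⟩
    rw [Module.Basis.tensorProduct_apply, Module.Basis.tensorProduct_apply, hi.basis_apply,
      hi.basis_apply]
    rfl
  rw [h]
  exact hb

lemma tensorCubeMap_injective : Function.Injective (tensorCubeMap L i) := by
  have hb := (hi.basis.tensorProduct (hi.basis.tensorProduct hi.basis)).linearIndependent
  refine injective_of_basis L ((Module.Basis.ofVectorSpace k H).tensorProduct
    ((Module.Basis.ofVectorSpace k H).tensorProduct
    (Module.Basis.ofVectorSpace k H))) (tensorCubeMap L i) ?_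
  have h : (fun j => tensorCubeMap L i (((Module.Basis.ofVectorSpace k H).tensorProduct
      ((Module.Basis.ofVectorSpace k H).tensorProduct (Module.Basis.ofVectorSpace k H))) j)) =
      hi.basis.tensorProduct (hi.basis.tensorProduct hi.basis) := by
    ext ⟨a, b, c⟩
    rw [Module.Basis.tensorProduct_apply, Module.Basis.tensorProduct_apply,
      Module.Basis.tensorProduct_apply, Module.Basis.tensorProduct_apply, hi.basis_apply,
      hi.basis_apply, hi.basis_apply]
    rfl
  rw [h]
  exact hb

/-- The comultiplication of the form `H`. -/
noncomputable def comulHom : H →ₐ[k] H ⊗[k] H :=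
  (AlgEquiv.ofInjective _ hi.tensorSquareMap_injective).symm.toAlgHom.comp
    ((((Bialgebra.comulAlgHom L A).restrictScalars k).comp i).codRestrict _ hi.comul_mem)

lemma tensorSquareMap_comulHom (h : H) :
    tensorSquareMap L i (hi.comulHom h) = Coalgebra.comul (R := L) (i h) :=
  congrArg Subtype.val
    ((AlgEquiv.ofInjective _ hi.tensorSquareMap_injective).apply_symm_apply
      ((((Bialgebra.comulAlgHom L A).restrictScalars k).comp i).codRestrict _ hi.comul_mem h))

/-- The counit of the form `H`. -/
noncomputable def counitHom : H →ₐ[k] k :=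
  (AlgEquiv.ofInjective _ (Algebra.ofId k L).injective).symm.toAlgHom.comp
    ((((Bialgebra.counitAlgHom L A).restrictScalars k).comp i).codRestrict _ hi.counit_mem)

lemma algebraMap_counitHom (h : H) :
    algebraMap k L (hi.counitHom h) = Coalgebra.counit (R := L) (i h) :=
  congrArg Subtype.val
    ((AlgEquiv.ofInjective _ (Algebra.ofId k L).injective).apply_symm_apply
      ((((Bialgebra.counitAlgHom L A).restrictScalars k).comp i).codRestrict _ hi.counit_mem h))

/-- The antipode of the form `H`. -/
noncomputable def antipodeHom : H →ₗ[k] H :=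
  (LinearEquiv.ofInjective i.toLinearMap hi.injective).symm.toLinearMap.comp
    ((((HopfAlgebra.antipode L (A := A)).restrictScalars k).comp i.toLinearMap).codRestrict _
      hi.antipode_mem)

lemma map_antipodeHom (h : H) : i (hi.antipodeHom h) = HopfAlgebra.antipode L (i h) :=
  congrArg Subtype.val
    ((LinearEquiv.ofInjective i.toLinearMap hi.injective).apply_symm_apply
      ((((HopfAlgebra.antipode L (A := A)).restrictScalars k).comp i.toLinearMap).codRestrict _
        hi.antipode_mem h))

lemma map_counitHom_smul (x y : H) :
    i (hi.counitHom x • y) = Coalgebra.counit (R := L) (i x) • i y := by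
  rw [map_smul, ← algebraMap_smul L, hi.algebraMap_counitHom]

/-- This lemma and the similar ones below carry the two sides of each Hopf algebra axiom from `H` to
`A`, where the axiom is known. -/
lemma map_lid_rTensor_counitHom (z : H ⊗[k] H) :
    i (TensorProduct.lid k H (hi.counitHom.toLinearMap.rTensor H z)) =
      TensorProduct.lid L A ((Coalgebra.counit (R := L)).rTensor A (tensorSquareMap L i z)) := by
  induction z with
  | zero => simp
  | add x y hx hy => simp only [map_add, hx, hy]
  | tmul x y => simpa using hi.map_counitHom_smul x y

lemma map_rid_lTensor_counitHom (z : H ⊗[k] H) :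
    i (TensorProduct.rid k H (hi.counitHom.toLinearMap.lTensor H z)) =
      TensorProduct.rid L A ((Coalgebra.counit (R := L)).lTensor A (tensorSquareMap L i z)) := by
  induction z with
  | zero => simp
  | add x y hx hy => simp only [map_add, hx, hy]
  | tmul x y => simpa using hi.map_counitHom_smul y x

lemma map_mul'_rTensor_antipodeHom (z : H ⊗[k] H) :
    i (LinearMap.mul' k H (hi.antipodeHom.rTensor H z)) =
      LinearMap.mul' L A ((HopfAlgebra.antipode L).rTensor A (tensorSquareMap L i z)) := by
  induction z with
  | zero => simp
  | add x y hx hy => simp only [map_add, hx, hy]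
  | tmul x y => simp [hi.map_antipodeHom]

lemma map_mul'_lTensor_antipodeHom (z : H ⊗[k] H) :
    i (LinearMap.mul' k H (hi.antipodeHom.lTensor H z)) =
      LinearMap.mul' L A ((HopfAlgebra.antipode L).lTensor A (tensorSquareMap L i z)) := by
  induction z with
  | zero => simp
  | add x y hx hy => simp only [map_add, hx, hy]
  | tmul x y => simp [hi.map_antipodeHom]

omit hi in
lemma tensorCubeMap_assoc (w : H ⊗[k] H) (y : H) :
    tensorCubeMap L i (TensorProduct.assoc k H H H (w ⊗ₜ y)) =
      TensorProduct.assoc L A A A (tensorSquareMap L i w ⊗ₜ i y) := by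
  induction w with
  | zero => simp
  | add x y hx hy => simp only [map_add, TensorProduct.add_tmul, hx, hy]
  | tmul x y => simp

lemma tensorCubeMap_assoc_rTensor_comulHom (z : H ⊗[k] H) :
    tensorCubeMap L i (TensorProduct.assoc k H H H (hi.comulHom.toLinearMap.rTensor H z)) =
      TensorProduct.assoc L A A A
        ((Coalgebra.comul (R := L)).rTensor A (tensorSquareMap L i z)) := by
  induction z with
  | zero => simp
  | add x y hx hy => simp only [map_add, hx, hy]
  | tmul x y =>
    simp only [LinearMap.rTensor_tmul, AlgHom.toLinearMap_apply, tensorCubeMap_assoc,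
      hi.tensorSquareMap_comulHom, tensorSquareMap_tmul]

lemma tensorCubeMap_lTensor_comulHom (z : H ⊗[k] H) :
    tensorCubeMap L i (hi.comulHom.toLinearMap.lTensor H z) =
      (Coalgebra.comul (R := L)).lTensor A (tensorSquareMap L i z) := by
  induction z with
  | zero => simp
  | add x y hx hy => simp only [map_add, hx, hy]
  | tmul x y => simp [hi.tensorSquareMap_comulHom]

/-- The coalgebra structure of the form `H`. -/
@[reducible]
noncomputable def coalgebra : Coalgebra k H where
  comul := hi.comulHom.toLinearMap
  counit := hi.counitHom.toLinearMap
  coassoc := by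
    ext h
    apply hi.tensorCubeMap_injective
    simp only [LinearMap.comp_apply, LinearEquiv.coe_coe]
    rw [hi.tensorCubeMap_assoc_rTensor_comulHom, hi.tensorCubeMap_lTensor_comulHom,
      AlgHom.toLinearMap_apply, hi.tensorSquareMap_comulHom, Coalgebra.coassoc_apply]
  rTensor_counit_comp_comul := by
    ext h
    apply (TensorProduct.lid k H).injective
    apply hi.injective
    simp only [LinearMap.comp_apply]
    rw [hi.map_lid_rTensor_counitHom, AlgHom.toLinearMap_apply, hi.tensorSquareMap_comulHom,
      Coalgebra.rTensor_counit_comul]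
    simp
  lTensor_counit_comp_comul := by
    ext h
    apply (TensorProduct.rid k H).injective
    apply hi.injective
    simp only [LinearMap.comp_apply]
    rw [hi.map_rid_lTensor_counitHom, AlgHom.toLinearMap_apply, hi.tensorSquareMap_comulHom,
      Coalgebra.lTensor_counit_comul]
    simp

/-- The bialgebra structure of the form `H`. -/
@[reducible]
noncomputable def bialgebra : Bialgebra k H :=
  letI := hi.coalgebra
  Bialgebra.mk' k H (map_one hi.counitHom) (map_mul hi.counitHom _ _) (map_one hi.comulHom)
    (map_mul hi.comulHom _ _)

/-- The Hopf algebra structure of the form `H`. -/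
@[reducible]
noncomputable def hopfAlgebra : HopfAlgebra k H :=
  { hi.bialgebra with
    antipode := hi.antipodeHom
    mul_antipode_rTensor_comul := by
      ext h
      apply hi.injective
      simp only [LinearMap.comp_apply]
      erw [hi.map_mul'_rTensor_antipodeHom, hi.tensorSquareMap_comulHom,
        HopfAlgebra.mul_antipode_rTensor_comul_apply]
      erw [Algebra.linearMap_apply, AlgHom.commutes, ← hi.algebraMap_counitHom,
        ← IsScalarTower.algebraMap_apply]
      rfl
    mul_antipode_lTensor_comul := by
      ext h
      apply hi.injective
      simp only [LinearMap.comp_apply]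
      erw [hi.map_mul'_lTensor_antipodeHom, hi.tensorSquareMap_comulHom,
        HopfAlgebra.mul_antipode_lTensor_comul_apply]
      erw [Algebra.linearMap_apply, AlgHom.commutes, ← hi.algebraMap_counitHom,
        ← IsScalarTower.algebraMap_apply]
      rfl }

omit hi in
lemma tensorSquareMap_comm (z : H ⊗[k] H) :
    tensorSquareMap L i (TensorProduct.comm k H H z) =
      TensorProduct.comm L A A (tensorSquareMap L i z) := by
  induction z with
  | zero => simp
  | add x y hx hy => simp only [map_add, hx, hy]
  | tmul x y => simp

lemma isCocomm [Coalgebra.IsCocomm L A] :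
    letI := hi.hopfAlgebra
    Coalgebra.IsCocomm k H :=
  letI := hi.hopfAlgebra
  { comm_comp_comul := by
      ext h
      apply hi.tensorSquareMap_injective
      refine (tensorSquareMap_comm _).trans ?_
      erw [hi.tensorSquareMap_comulHom, Coalgebra.comm_comul] }

/-- The algebra isomorphism `L ⊗_k H ≃ A` for a `k`-form `H` of `A`. -/
noncomputable def algEquiv : L ⊗[k] H ≃ₐ[L] A :=
  AlgEquiv.ofBijective
    (Algebra.TensorProduct.lift (Algebra.ofId L A) i fun l h => Algebra.commutes l (i h)) <| by
    -- On a basis the map agrees with the linear equivalence matching the two bases, so it is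
    -- bijective.
    have h : (Algebra.TensorProduct.lift (Algebra.ofId L A) i
        fun l h => Algebra.commutes l (i h)).toLinearMap =
      ((Algebra.TensorProduct.basis L (Module.Basis.ofVectorSpace k H)).equiv hi.basis
        (Equiv.refl _)).toLinearMap := by
      refine (Algebra.TensorProduct.basis L (Module.Basis.ofVectorSpace k H)).ext fun j => ?_
      rw [LinearEquiv.coe_coe, Module.Basis.equiv_apply, Equiv.refl_apply, hi.basis_apply,
        Algebra.TensorProduct.basis_apply, AlgHom.toLinearMap_apply]
      change Algebra.ofId L A 1 * i _ = _
      rw [map_one, one_mul]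
    have h2 := LinearEquiv.bijective
      ((Algebra.TensorProduct.basis L (Module.Basis.ofVectorSpace k H)).equiv hi.basis
        (Equiv.refl _))
    rw [← LinearEquiv.coe_toLinearMap, ← h] at h2
    exact h2

lemma algEquiv_tmul (l : L) (h : H) : hi.algEquiv (l ⊗ₜ h) = l • i h := by
  rw [Algebra.smul_def]
  rfl

/-- The bialgebra isomorphism `L ⊗_k H ≃ A` for a `k`-form `H` of `A`. -/
noncomputable def bialgEquiv :
    letI := hi.hopfAlgebra
    L ⊗[k] H ≃ₐc[L] A :=
  letI := hi.hopfAlgebra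
  BialgEquiv.ofAlgEquiv hi.algEquiv
    (by
      apply Algebra.TensorProduct.ext (by ext)
      ext h
      change Coalgebra.counit (R := L) (hi.algEquiv (1 ⊗ₜ h)) =
        Coalgebra.counit (R := L) ((1 : L) ⊗ₜ[k] h)
      rw [hi.algEquiv_tmul, one_smul, TensorProduct.counit_tmul, CommSemiring.counit_apply,
        ← hi.algebraMap_counitHom, Algebra.smul_def, mul_one]
      rfl)
    (by
      apply Algebra.TensorProduct.ext (by ext)
      ext h
      change Algebra.TensorProduct.map hi.algEquiv.toAlgHom hi.algEquiv.toAlgHom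
          (Coalgebra.comul (R := L) ((1 : L) ⊗ₜ[k] h)) =
        Coalgebra.comul (R := L) (hi.algEquiv (1 ⊗ₜ h))
      rw [hi.algEquiv_tmul, one_smul, ← hi.tensorSquareMap_comulHom, TensorProduct.comul_tmul,
        CommSemiring.comul_apply]
      change _ = tensorSquareMap L i (Coalgebra.comul (R := k) h)
      generalize Coalgebra.comul (R := k) h = z
      induction z with
      | zero => simp
      | add x y hx hy => simp only [map_add, TensorProduct.tmul_add, hx, hy]
      | tmul x y => simp [hi.algEquiv_tmul])

end IsHopfDescent

end Descent

/-! ### The invariants of a group algebra under a twisted Galois action -/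

section Invariants

variable {k L N : Type*} [Field k] [Field L] [Algebra k L] [Group N]

/-- The semilinear action of a Galois automorphism `γ` on the group algebra `L[N]`, where the
Galois group acts on `N` through `θ`. -/
noncomputable def twist (θ : (L ≃ₐ[k] L) →* MulAut N) (γ : L ≃ₐ[k] L) :
    MonoidAlgebra L N →ₐ[k] MonoidAlgebra L N :=
  (MonoidAlgebra.mapAlgHom N γ.toAlgHom).comp
    (MonoidAlgebra.mapDomainAlgHom k L (θ γ).toMonoidHom)

@[simp]
lemma twist_single (θ : (L ≃ₐ[k] L) →* MulAut N) (γ : L ≃ₐ[k] L) (n : N) (a : L) :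
    twist θ γ (MonoidAlgebra.single n a) = MonoidAlgebra.single (θ γ n) (γ a) := by
  simp [twist]

lemma twist_smul (θ : (L ≃ₐ[k] L) →* MulAut N) (γ : L ≃ₐ[k] L) (l : L)
    (x : MonoidAlgebra L N) : twist θ γ (l • x) = γ l • twist θ γ x := by
  induction x using MonoidAlgebra.induction_linear with
  | zero => simp
  | add x y hx hy => simp only [smul_add, map_add, hx, hy]
  | single n a => simp

/-- The `k`-algebra of invariants of the semilinear action of `Gal(L/k)` on `L[N]`. -/
noncomputable def invariants (θ : (L ≃ₐ[k] L) →* MulAut N) :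
    Subalgebra k (MonoidAlgebra L N) :=
  ⨅ γ, AlgHom.equalizer (twist θ γ) (AlgHom.id k _)

lemma mem_invariants {θ : (L ≃ₐ[k] L) →* MulAut N} {x : MonoidAlgebra L N} :
    x ∈ invariants θ ↔ ∀ γ, twist θ γ x = x := by
  simp [invariants, Algebra.mem_iInf]

variable [FiniteDimensional k L]

/-- The sum of the images of `a n` under the Galois group. -/
noncomputable def orbitSum (θ : (L ≃ₐ[k] L) →* MulAut N) (n : N) (a : L) : MonoidAlgebra L N :=
  ∑ γ : L ≃ₐ[k] L, MonoidAlgebra.single (θ γ n) (γ a)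

lemma orbitSum_mem (θ : (L ≃ₐ[k] L) →* MulAut N) (n : N) (a : L) :
    orbitSum θ n a ∈ invariants θ := by
  rw [mem_invariants]
  intro δ
  rw [orbitSum, map_sum]
  refine Fintype.sum_equiv (Equiv.mulLeft δ) _ _ fun γ => ?_
  simp

variable [IsGalois k L]

/-- The trace form of a Galois extension has dual bases: there are finite families `b`, `b'` with
`∑ i, γ (b i) * δ (b' i)` equal to `1` if `γ = δ` and to `0` otherwise. -/
lemma exists_dual_families (k L : Type*) [Field k] [Field L] [Algebra k L]
    [FiniteDimensional k L] [IsGalois k L] [DecidableEq (L ≃ₐ[k] L)] :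
    ∃ b b' : Fin (Module.finrank k L) → L, ∀ γ δ : L ≃ₐ[k] L,
      ∑ i, γ (b i) * δ (b' i) = if γ = δ then 1 else 0 := by
  let b := Module.finBasis k L
  let P : Matrix (Fin (Module.finrank k L)) (L ≃ₐ[k] L) L := fun i γ => γ (b i)
  let Q : Matrix (L ≃ₐ[k] L) (Fin (Module.finrank k L)) L := fun γ i => γ (b.traceDual i)
  have hPQ : P * Q = 1 := by
    ext i j
    rw [Matrix.mul_apply]
    have h := congrArg (algebraMap k L) (b.trace_mul_traceDual i j)
    rw [trace_eq_sum_automorphisms] at h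
    simp only [map_mul] at h
    refine h.trans ?_
    by_cases hij : i = j <;> simp [Matrix.one_apply, hij]
  -- Duality for the trace form says `P * Q = 1`. Both index sets have [L:k] elements, so the
  -- one-sided inverse is two-sided.
  have hQP : Q * P = 1 := by
    refine (Matrix.mul_eq_one_comm_of_card_eq _ _ _ ?_).1 hPQ
    rw [Fintype.card_fin, ← Nat.card_eq_fintype_card, IsGalois.card_aut_eq_finrank]
  refine ⟨b, b.traceDual, fun γ δ => ?_⟩
  have h := congrFun (congrFun hQP δ) γ
  rw [Matrix.mul_apply, Matrix.one_apply] at h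
  simp only [P, Q] at h
  simp_rw [mul_comm (γ _)]
  rw [h]
  simp [eq_comm]

variable (θ : (L ≃ₐ[k] L) →* MulAut N)

/-- On an invariant `x` the twist only moves the scalar, so the sum collapses to a trace. -/
lemma sum_twist_smul (b : L) (x : MonoidAlgebra L N) (hx : x ∈ invariants θ) :
    ∑ γ : L ≃ₐ[k] L, twist θ γ (b • x) = Algebra.trace k L b • x := by
  simp_rw [twist_smul, mem_invariants.1 hx, ← Finset.sum_smul]
  rw [← trace_eq_sum_automorphisms, algebraMap_smul]

/-- An invariant of `L[N]` is a finite sum of orbit sums. -/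
lemma invariants_induction {p : MonoidAlgebra L N → Prop}
    (hsum : ∀ n a, p (orbitSum θ n a)) (h0 : p 0) (hadd : ∀ x y, p x → p y → p (x + y))
    {x : MonoidAlgebra L N} (hx : x ∈ invariants θ) : p x := by
  -- With `b` of trace 1, averaging `b • x` returns `x`; expanding `b • x` in group elements yields
  -- orbit sums.
  obtain ⟨b, hb⟩ := Algebra.trace_surjective k L 1
  have h1 : x = ∑ γ : L ≃ₐ[k] L, twist θ γ (b • x) := by
    rw [sum_twist_smul θ b x hx, hb, one_smul]
  have h2 : ∀ y : MonoidAlgebra L N, p (∑ γ : L ≃ₐ[k] L, twist θ γ y) := by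
    intro y
    induction y using MonoidAlgebra.induction_linear with
    | zero => simpa using h0
    | add y z hy hz =>
      simp only [map_add, Finset.sum_add_distrib]
      exact hadd _ _ hy hz
    | single n a =>
      simp only [twist_single]
      exact hsum n a
  rw [h1]
  exact h2 _

/-- Multiplying an L-relation by an arbitrary `b` and summing over the Galois group gives a
k-relation with coefficients Tr(b·g j). These all vanish, and since the trace is nonzero, g j = 0.
-/
lemma linearIndependent_invariants {ι : Type*} {v : ι → invariants θ}
    (hv : LinearIndependent k v) :
    LinearIndependent L fun j => (v j : MonoidAlgebra L N) := by
  rw [linearIndependent_iff']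
  intro s g hg j hj
  have h1 : ∀ b : L, Algebra.trace k L (b * g j) = 0 := by
    intro b
    have h2 : ∑ j ∈ s, Algebra.trace k L (b * g j) • v j = 0 := by
      apply Subtype.ext
      have h3 : ∑ γ : L ≃ₐ[k] L, twist θ γ (b • ∑ j ∈ s, g j • (v j : MonoidAlgebra L N)) = 0 := by
        simp [hg]
      refine Eq.trans ?_ h3
      simp_rw [Finset.smul_sum, smul_smul, map_sum]
      rw [Finset.sum_comm]
      simp_rw [sum_twist_smul θ _ _ (v _).2]
      simp
    exact linearIndependent_iff'.1 hv s _ h2 j hj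
  by_contra hne
  obtain ⟨b, hb⟩ := Algebra.trace_surjective k L 1
  have h2 := h1 (b * (g j)⁻¹)
  rw [mul_assoc, inv_mul_cancel₀ hne, mul_one, hb] at h2
  exact one_ne_zero h2

-- Orthogonality of the dual families removes every term except the one for the identity. Hence the
-- invariants span `L[N]` over `L`.
omit [IsGalois k L] in
lemma sum_smul_orbitSum [DecidableEq (L ≃ₐ[k] L)] {b b' : Fin (Module.finrank k L) → L}
    (hb : ∀ γ δ : L ≃ₐ[k] L, ∑ i, γ (b i) * δ (b' i) = if γ = δ then 1 else 0) (n : N) :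
    ∑ i, b i • orbitSum θ n (b' i) = MonoidAlgebra.single n 1 := by
  have h1 : ∀ γ : L ≃ₐ[k] L, ∑ i, b i • (MonoidAlgebra.single (θ γ n) (γ (b' i)) :
      MonoidAlgebra L N) = if 1 = γ then MonoidAlgebra.single n 1 else 0 := by
    intro γ
    simp only [MonoidAlgebra.smul_single, smul_eq_mul]
    refine (map_sum (MonoidAlgebra.lsingle (R := L) (θ γ n)) (fun i => b i * γ (b' i))
      Finset.univ).symm.trans ?_
    have h2 := hb 1 γ
    simp only [AlgEquiv.one_apply] at h2
    rw [h2]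
    split_ifs with h
    · simp [← h]
    · simp
  simp_rw [orbitSum, Finset.smul_sum]
  rw [Finset.sum_comm]
  simp_rw [h1]
  simp

-- Orthogonality removes the cross terms γ ≠ δ, leaving the diagonal comultiplication of group
-- elements. This exhibits the coproduct of an orbit sum as a tensor of invariants.
omit [IsGalois k L] in
lemma comul_orbitSum [DecidableEq (L ≃ₐ[k] L)] {b b' : Fin (Module.finrank k L) → L}
    (hb : ∀ γ δ : L ≃ₐ[k] L, ∑ i, γ (b i) * δ (b' i) = if γ = δ then 1 else 0) (n : N) (a : L) :
    ∑ i, orbitSum θ n (a * b i) ⊗ₜ[L] orbitSum θ n (b' i) =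
      Coalgebra.comul (R := L) (orbitSum θ n a) := by
  have h1 : ∀ γ δ : L ≃ₐ[k] L, ∑ i, (MonoidAlgebra.single (θ γ n) (γ (a * b i)) :
      MonoidAlgebra L N) ⊗ₜ[L] (MonoidAlgebra.single (θ δ n) (δ (b' i)) : MonoidAlgebra L N) =
      if γ = δ then Coalgebra.comul (R := L)
        (MonoidAlgebra.single (θ γ n) (γ a) : MonoidAlgebra L N) else 0 := by
    intro γ δ
    have h2 : ∀ i, (MonoidAlgebra.single (θ γ n) (γ (a * b i)) :
      MonoidAlgebra L N) ⊗ₜ[L] (MonoidAlgebra.single (θ δ n) (δ (b' i)) : MonoidAlgebra L N) =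
      (γ (b i) * δ (b' i)) • ((MonoidAlgebra.single (θ γ n) (γ a) :
      MonoidAlgebra L N) ⊗ₜ[L] (MonoidAlgebra.single (θ δ n) 1 : MonoidAlgebra L N)) := by
      intro i
      rw [mul_smul, ← TensorProduct.tmul_smul, TensorProduct.smul_tmul']
      simp [mul_comm]
    simp_rw [h2, ← Finset.sum_smul, hb]
    split_ifs with h
    · have h3 : (MonoidAlgebra.single (θ γ n) (γ a) : MonoidAlgebra L N) =
          γ a • MonoidAlgebra.single (θ γ n) 1 := by simp
      rw [← h, one_smul, h3, TensorProduct.smul_tmul]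
      simp
    · simp
  simp_rw [orbitSum, TensorProduct.sum_tmul, TensorProduct.tmul_sum, map_sum]
  rw [Finset.sum_comm]
  refine Finset.sum_congr rfl fun γ _ => ?_
  rw [Finset.sum_comm]
  simp_rw [h1]
  simp

/-- The invariants of `L[N]` form a Hopf algebra over `k`. -/
lemma isHopfDescent_invariants : IsHopfDescent L (invariants θ).val := by
  classical
  obtain ⟨b, b', hb⟩ := exists_dual_families k L
  refine ⟨linearIndependent_invariants θ (Module.Basis.ofVectorSpace k _).linearIndependent,
    ?_, ?_, ?_, ?_⟩
  · rw [eq_top_iff]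
    rintro x -
    induction x using MonoidAlgebra.induction_linear with
    | zero => exact zero_mem _
    | add x y hx hy => exact add_mem hx hy
    | single n a =>
      have h1 : (MonoidAlgebra.single n a : MonoidAlgebra L N) =
          a • MonoidAlgebra.single n 1 := by simp
      rw [h1, ← sum_smul_orbitSum θ hb n]
      refine Submodule.smul_mem _ _ (Submodule.sum_mem _ fun i _ => Submodule.smul_mem _ _
        (Submodule.subset_span ⟨⟨_, orbitSum_mem θ n (b' i)⟩, rfl⟩))
  · rintro ⟨x, hx⟩
    change Coalgebra.comul (R := L) x ∈ _
    refine invariants_induction θ (p := fun x => Coalgebra.comul (R := L) x ∈ _) ?_ ?_ ?_ hx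
    · intro n a
      rw [← comul_orbitSum θ hb]
      exact ⟨∑ i, (⟨_, orbitSum_mem θ n (a * b i)⟩ : invariants θ) ⊗ₜ
        (⟨_, orbitSum_mem θ n (b' i)⟩ : invariants θ), by simp⟩
    · simp [zero_mem]
    · intro x y hx hy
      rw [map_add]
      exact add_mem hx hy
  · rintro ⟨x, hx⟩
    change Coalgebra.counit (R := L) x ∈ _
    refine invariants_induction θ (p := fun x => Coalgebra.counit (R := L) x ∈ _) ?_ ?_ ?_ hx
    · intro n a
      -- The counit adds the coefficients, which are the conjugates of `a`.
      refine ⟨Algebra.trace k L a, ?_⟩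
      simp [orbitSum, trace_eq_sum_automorphisms]
    · simp [zero_mem]
    · intro x y hx hy
      rw [map_add]
      exact add_mem hx hy
  · rintro ⟨x, hx⟩
    change HopfAlgebra.antipode L x ∈ _
    refine invariants_induction θ (p := fun x => HopfAlgebra.antipode L x ∈ _) ?_ ?_ ?_ hx
    · intro n a
      exact ⟨⟨_, orbitSum_mem θ n⁻¹ a⟩, by simp [orbitSum]⟩
    · simp [zero_mem]
    · intro x y hx hy
      rw [map_add]
      exact add_mem hx hy

end Invariants

/-! ### Crossed homomorphisms and Hopf Galois structures -/

/-- A surjective crossed homomorphism `f : G → N`, for an action `θ` of `G` on `N`, whose fibre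
over `1` is the subgroup `G'`. It identifies `G/G'` with `N`. -/
structure IsCrossedParam {G N : Type*} [Group G] [Group N] (G' : Subgroup G)
    (θ : G →* MulAut N) (f : G → N) : Prop where
  surjective : Function.Surjective f
  map_mul : ∀ γ δ, f (γ * δ) = f γ * θ γ (f δ)
  eq_one_iff : ∀ γ, f γ = 1 ↔ γ ∈ G'

namespace IsCrossedParam

variable {G N : Type*} [Group G] [Group N] {G' : Subgroup G} {θ : G →* MulAut N} {f : G → N}

lemma map_one (hf : IsCrossedParam G' θ f) : f 1 = 1 :=
  (hf.eq_one_iff 1).2 G'.one_mem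

/-- The crossed identity turns the fibre over 1 into a description of all fibres: they are the left
cosets of `G'`. -/
lemma eq_iff (hf : IsCrossedParam G' θ f) (γ δ : G) : f γ = f δ ↔ γ⁻¹ * δ ∈ G' := by
  constructor
  · intro h
    rw [← hf.eq_one_iff, hf.map_mul, ← h, ← hf.map_mul, inv_mul_cancel, hf.map_one]
  · intro h
    have h1 : f δ = f γ * θ γ (f (γ⁻¹ * δ)) := by rw [← hf.map_mul, mul_inv_cancel_left]
    rw [h1, (hf.eq_one_iff _).2 h, _root_.map_one, mul_one]

lemma card_eq_index (hf : IsCrossedParam G' θ f) : Nat.card N = G'.index := by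
  symm
  refine Nat.card_congr (Equiv.ofBijective
    (Quotient.lift f fun a b h => (hf.eq_iff a b).2 (QuotientGroup.leftRel_apply.1 h)) ⟨?_, ?_⟩)
  · intro x y
    induction x using Quotient.inductionOn
    induction y using Quotient.inductionOn
    intro h
    exact Quotient.sound (QuotientGroup.leftRel_apply.2 ((hf.eq_iff _ _).1 h))
  · intro n
    obtain ⟨γ, rfl⟩ := hf.surjective n
    exact ⟨Quotient.mk'' γ, rfl⟩

end IsCrossedParam

section Action

variable {k : Type u} {L : Type v} [Field k] [Field L] [Algebra k L] {F : IntermediateField k L}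
  {N : Type} [Group N] {θ : (L ≃ₐ[k] L) →* MulAut N} {f : (L ≃ₐ[k] L) → N}
  (hf : IsCrossedParam F.fixingSubgroup θ f)

namespace IsCrossedParam

/-- The embedding `F → L` corresponding to an element of `N`. -/
noncomputable def embedding (n : N) : F →ₐ[k] L :=
  (Function.surjInv hf.surjective n).toAlgHom.comp F.val

include hf in
lemma apply_eq_of_eq {γ δ : L ≃ₐ[k] L} (h : f γ = f δ) (t : F) : γ t = δ t := by
  have h1 := (hf.eq_iff γ δ).1 h
  have h2 : (γ⁻¹ * δ) (t : L) = t := (IntermediateField.mem_fixingSubgroup_iff _ _).1 h1 t t.2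
  have h3 := congrArg γ h2
  rw [AlgEquiv.mul_apply] at h3
  rw [← h3]
  exact AlgEquiv.apply_symm_apply γ _

lemma embedding_apply (γ : L ≃ₐ[k] L) (t : F) : hf.embedding (f γ) t = γ t :=
  hf.apply_eq_of_eq (Function.surjInv_eq hf.surjective (f γ)) t

lemma embedding_injective : Function.Injective hf.embedding := by
  intro m n h
  obtain ⟨γ, rfl⟩ := hf.surjective m
  obtain ⟨δ, rfl⟩ := hf.surjective n
  rw [hf.eq_iff, IntermediateField.mem_fixingSubgroup_iff]
  intro t ht
  have h1 := DFunLike.congr_fun h ⟨t, ht⟩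
  rw [hf.embedding_apply, hf.embedding_apply] at h1
  change γ.symm (δ t) = t
  rw [AlgEquiv.symm_apply_eq]
  exact h1.symm

/-- The map from `L[N]` to the `k`-linear maps `F → L` sending `n` to the corresponding
embedding. -/
noncomputable def evalMap : MonoidAlgebra L N →ₗ[L] (F →ₗ[k] L) :=
  (Finsupp.linearCombination L fun n => (hf.embedding n).toLinearMap) ∘ₗ
    (MonoidAlgebra.coeffLinearEquiv L).toLinearMap

@[simp]
lemma evalMap_single (n : N) (a : L) (t : F) :
    hf.evalMap (MonoidAlgebra.single n a) t = a * hf.embedding n t := by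
  simp [evalMap]

/-- Dedekind's independence of characters, applied to the pairwise distinct embeddings of `F`. -/
lemma evalMap_injective : Function.Injective hf.evalMap := by
  have h : Function.Injective (Finsupp.linearCombination L
      fun n => (hf.embedding n).toLinearMap) :=
    (linearIndependent_algHom_toLinearMap k F L).comp _ hf.embedding_injective
  exact h.comp (LinearEquiv.injective _)

/-- The crossed identity in linear form: γ composed with the embedding of f(δ) is the embedding of
f(γδ) = f(γ)·θ_γ(f(δ)). Stability of `F` and multiplicativity of the action both follow from it. -/
lemma apply_evalMap (γ : L ≃ₐ[k] L) (x : MonoidAlgebra L N) (t : F) :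
    γ (hf.evalMap x t) = hf.evalMap (MonoidAlgebra.single (f γ) 1 * twist θ γ x) t := by
  induction x using MonoidAlgebra.induction_linear with
  | zero => simp
  | add x y hx hy => simp only [map_add, mul_add, LinearMap.add_apply, hx, hy]
  | single n a =>
    obtain ⟨δ, rfl⟩ := hf.surjective n
    rw [twist_single, MonoidAlgebra.single_mul_single, hf.evalMap_single, hf.evalMap_single,
      ← hf.map_mul, hf.embedding_apply, hf.embedding_apply, _root_.map_mul, one_mul]
    rfl

lemma evalMap_one (t : F) : hf.evalMap 1 t = t := by
  rw [MonoidAlgebra.one_def, hf.evalMap_single, ← hf.map_one, hf.embedding_apply, one_mul]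
  rfl

variable [FiniteDimensional k L] [IsGalois k L]

/-- For γ in Gal(L/F) both f(γ) = 1 and invariance of `x` apply, so γ fixes the value and the Galois
correspondence places it in `F`. -/
lemma evalMap_mem (x : invariants θ) (t : F) : hf.evalMap x t ∈ F := by
  suffices h : hf.evalMap x t ∈ IntermediateField.fixedField F.fixingSubgroup by
    rwa [IsGalois.fixedField_fixingSubgroup F] at h
  rw [IntermediateField.mem_fixedField_iff]
  intro γ hγ
  rw [hf.apply_evalMap, (hf.eq_one_iff γ).2 hγ, mem_invariants.1 x.2, ← MonoidAlgebra.one_def,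
    one_mul]

/-- The endomorphism of `F` given by an invariant element of `L[N]`. -/
noncomputable def endOfInvariant (x : invariants θ) : Module.End k F where
  toFun t := ⟨hf.evalMap x t, hf.evalMap_mem x t⟩
  map_add' _ _ := Subtype.ext (map_add _ _ _)
  map_smul' _ _ := Subtype.ext (map_smul _ _ _)

lemma evalMap_mul (x : MonoidAlgebra L N) (y : invariants θ) (t : F) :
    hf.evalMap (x * y) t = hf.evalMap x (hf.endOfInvariant y t) := by
  induction x using MonoidAlgebra.induction_linear with
  | zero => simp
  | add x y hx hy => simp only [map_add, add_mul, LinearMap.add_apply, hx, hy]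
  | single n a =>
    obtain ⟨γ, rfl⟩ := hf.surjective n
    rw [hf.evalMap_single, hf.embedding_apply]
    change _ = a * γ (hf.evalMap y t)
    rw [hf.apply_evalMap, mem_invariants.1 y.2]
    have h : (MonoidAlgebra.single (f γ) a : MonoidAlgebra L N) =
        a • MonoidAlgebra.single (f γ) 1 := by simp
    rw [h, smul_mul_assoc, map_smul]
    rfl

/-- The action of the invariants of `L[N]` on `F`. -/
noncomputable def action : invariants θ →ₐ[k] Module.End k F where
  toFun := hf.endOfInvariant
  map_one' := LinearMap.ext fun t => Subtype.ext (hf.evalMap_one t)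
  map_mul' x y := LinearMap.ext fun t => Subtype.ext (hf.evalMap_mul x y t)
  map_zero' := LinearMap.ext fun t => Subtype.ext (by
    change hf.evalMap 0 t = 0
    simp)
  map_add' x y := LinearMap.ext fun t => Subtype.ext (by
    change hf.evalMap (x + y) t = hf.evalMap x t + hf.evalMap y t
    simp)
  commutes' c := LinearMap.ext fun t => Subtype.ext (by
    change hf.evalMap (algebraMap k (MonoidAlgebra L N) c) t = ((c • t : F) : L)
    rw [IsScalarTower.algebraMap_apply k L, Algebra.algebraMap_eq_smul_one, map_smul,
      LinearMap.smul_apply, hf.evalMap_one, algebraMap_smul]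
    rfl)

lemma coe_action (x : invariants θ) (t : F) : (hf.action x t : L) = hf.evalMap x t := rfl

/-- The bilinear extension of `(x, y) ↦ x(s) y(t)`. -/
noncomputable def evalPair (s t : F) : MonoidAlgebra L N ⊗[L] MonoidAlgebra L N →ₗ[L] L :=
  LinearMap.mul' L L ∘ₗ TensorProduct.map (hf.evalMap.flip s) (hf.evalMap.flip t)

omit [FiniteDimensional k L] [IsGalois k L] in
lemma evalMap_apply_mul (x : MonoidAlgebra L N) (s t : F) :
    hf.evalMap x (s * t) = hf.evalPair s t (Coalgebra.comul (R := L) x) := by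
  induction x using MonoidAlgebra.induction_linear with
  | zero => simp
  | add x y hx hy => simp only [map_add, LinearMap.add_apply, hx, hy]
  | single n a => simp [evalPair, mul_left_comm]

omit [FiniteDimensional k L] [IsGalois k L] in
lemma evalMap_apply_one (x : MonoidAlgebra L N) :
    hf.evalMap x 1 = Coalgebra.counit (R := L) x := by
  induction x using MonoidAlgebra.induction_linear with
  | zero => simp
  | add x y hx hy => simp only [map_add, LinearMap.add_apply, hx, hy]
  | single n a => simp

lemma coe_mul'_map_action (z : invariants θ ⊗[k] invariants θ) (s t : F) :
    (LinearMap.mul' k F (TensorProduct.map (hf.action.toLinearMap.flip s)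
      (hf.action.toLinearMap.flip t) z) : L) =
      hf.evalPair s t (tensorSquareMap L (invariants θ).val z) := by
  induction z with
  | zero => simp
  | add x y hx hy => simp only [map_add, IntermediateField.coe_add, hx, hy]
  | tmul x y => simp [evalPair, coe_action]

lemma isModuleAlgebra_action :
    letI := (isHopfDescent_invariants θ).hopfAlgebra
    IsModuleAlgebra k F (invariants θ) hf.action := by
  let := (isHopfDescent_invariants θ).hopfAlgebra
  refine ⟨fun h s t => Subtype.ext ?_, fun h => Subtype.ext ?_⟩
  · refine Eq.trans ?_ (hf.coe_mul'_map_action _ s t).symm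
    erw [(isHopfDescent_invariants θ).tensorSquareMap_comulHom]
    exact hf.evalMap_apply_mul h s t
  · refine Eq.trans (hf.evalMap_apply_one h) ?_
    exact ((isHopfDescent_invariants θ).algebraMap_counitHom h).symm

/-- The map `F ⊗_k L[N]^G → L[N]` given by scalar multiplication. -/
noncomputable def scalarMap (F : IntermediateField k L) (θ : (L ≃ₐ[k] L) →* MulAut N) :
    F ⊗[k] invariants θ →ₗ[k] MonoidAlgebra L N :=
  ((isHopfDescent_invariants θ).algEquiv.toLinearMap.restrictScalars k).comp
    (F.val.toLinearMap.rTensor (invariants θ))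

lemma scalarMap_tmul (s : F) (h : invariants θ) :
    scalarMap F θ (s ⊗ₜ h) = (s : L) • (h : MonoidAlgebra L N) :=
  (isHopfDescent_invariants θ).algEquiv_tmul _ _

lemma scalarMap_injective : Function.Injective (scalarMap F θ) :=
  (isHopfDescent_invariants θ).algEquiv.injective.comp
    (Module.Flat.rTensor_preserves_injective_linearMap _ F.val.injective)

/-- Factors the Galois map through two injections, so that only a dimension count remains for
bijectivity. -/
lemma coe_galoisMap_action (z : F ⊗[k] invariants θ) (t : F) :
    letI := (isHopfDescent_invariants θ).hopfAlgebra
    (galoisMap k F (invariants θ) hf.action z t : L) = hf.evalMap (scalarMap F θ z) t := by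
  let := (isHopfDescent_invariants θ).hopfAlgebra
  induction z with
  | zero => simp
  | add x y hx hy =>
    simp only [map_add, LinearMap.add_apply, IntermediateField.coe_add]
    rw [← hx, ← hy]
  | tmul s h =>
    rw [scalarMap_tmul, map_smul]
    rfl

lemma finite_invariants [Finite N] : Module.Finite k (invariants θ) := by
  have : Module.Finite L (MonoidAlgebra L N) :=
    Module.Finite.equiv (MonoidAlgebra.coeffLinearEquiv (S := L) (M := N) L).symm
  have := Module.Finite.finite_basis (isHopfDescent_invariants θ).basis
  exact Module.Finite.of_basis (Module.Basis.ofVectorSpace k _)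

lemma finrank_invariants [Finite N] : Module.finrank k (invariants θ) = Nat.card N := by
  have : Fintype N := Fintype.ofFinite N
  rw [Module.finrank_eq_nat_card_basis (Module.Basis.ofVectorSpace k (invariants θ)),
    ← Module.finrank_eq_nat_card_basis (isHopfDescent_invariants θ).basis,
    (MonoidAlgebra.coeffLinearEquiv (S := L) (M := N) L).finrank_eq,
    Module.finrank_finsupp_self, Nat.card_eq_fintype_card]

lemma galoisMap_action_bijective :
    letI := (isHopfDescent_invariants θ).hopfAlgebra
    Function.Bijective (galoisMap k F (invariants θ) hf.action) := by
  let := (isHopfDescent_invariants θ).hopfAlgebra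
  have : Finite N := Finite.of_surjective f hf.surjective
  have := finite_invariants (θ := θ)
  have hinj : Function.Injective (galoisMap k F (invariants θ) hf.action) := by
    intro x y hxy
    apply scalarMap_injective
    apply hf.evalMap_injective
    ext t
    rw [← hf.coe_galoisMap_action, ← hf.coe_galoisMap_action, hxy]
  -- Both sides have dimension [F:k]², since dim H = |N| = [G:G'] = [F:k].
  refine ⟨hinj, (LinearMap.injective_iff_surjective_of_finrank_eq_finrank ?_).1 hinj⟩
  have h1 : Module.finrank k (invariants θ) = Module.finrank k F := by
    rw [finrank_invariants, hf.card_eq_index]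
    exact (IntermediateField.finrank_eq_fixingSubgroup_index _ F).symm
  rw [Module.finrank_tensorProduct, Module.finrank_linearMap]
  exact congrArg _ h1

include hf in
/-- A surjective crossed homomorphism onto `N` with fibre `Gal(L/F)` over `1` gives a Hopf Galois
structure of type `N` on `F/k`. -/
theorem hasHopfGaloisStructureOfType : HasHopfGaloisStructureOfType k F L N := by
  have : Finite N := Finite.of_surjective f hf.surjective
  let := (isHopfDescent_invariants θ).hopfAlgebra
  exact ⟨inferInstance, invariants θ, inferInstance, (isHopfDescent_invariants θ).hopfAlgebra,
    hf.action, ⟨finite_invariants, (isHopfDescent_invariants θ).isCocomm,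
      hf.isModuleAlgebra_action, hf.galoisMap_action_bijective⟩,
    ⟨(isHopfDescent_invariants θ).bialgEquiv⟩⟩

end IsCrossedParam

end Action

/-! ### The group-like elements attached to a Hopf Galois structure -/

section Converse

variable {k : Type u} {L : Type v} [Field k] [Field L] [Algebra k L] {F : IntermediateField k L}
  {H : Type v} [Ring H] [HopfAlgebra k H] (μ : H →ₐ[k] Module.End k F)

/-- The `L`-linear map `L ⊗_k H → Hom_k(F, L)`, `l ⊗ h ↦ (t ↦ l h(t))`. -/
noncomputable def baseChangeAction : L ⊗[k] H →ₗ[L] (F →ₗ[k] L) :=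
  LinearMap.liftBaseChange L ((F.val.toLinearMap.compRight k) ∘ₗ μ.toLinearMap)

@[simp]
lemma baseChangeAction_tmul (l : L) (h : H) (t : F) :
    baseChangeAction μ (l ⊗ₜ h) t = l * (μ h t : L) := by
  simp [baseChangeAction]

/-- The semilinear action of the Galois group on `L ⊗_k H`. -/
noncomputable def galoisTensor (H : Type v) [Ring H] [HopfAlgebra k H] (γ : L ≃ₐ[k] L) :
    L ⊗[k] H →ₐ[k] L ⊗[k] H :=
  Algebra.TensorProduct.map γ.toAlgHom (AlgHom.id k H)

@[simp]
lemma galoisTensor_tmul (γ : L ≃ₐ[k] L) (l : L) (h : H) :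
    galoisTensor H γ (l ⊗ₜ h) = γ l ⊗ₜ h := by
  simp [galoisTensor]

lemma galoisTensor_one (x : L ⊗[k] H) : galoisTensor H (1 : L ≃ₐ[k] L) x = x := by
  induction x with
  | zero => simp
  | add x y hx hy => simp only [map_add, hx, hy]
  | tmul l h => simp

lemma galoisTensor_mul (γ δ : L ≃ₐ[k] L) (x : L ⊗[k] H) :
    galoisTensor H (γ * δ) x = galoisTensor H γ (galoisTensor H δ x) := by
  induction x with
  | zero => simp
  | add x y hx hy => simp only [map_add, hx, hy]
  | tmul l h => simp

lemma baseChangeAction_one (t : F) : baseChangeAction μ 1 t = t := by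
  simp [Algebra.TensorProduct.one_def]

lemma baseChangeAction_mul_tmul (x : L ⊗[k] H) (l : L) (h : H) (t : F) :
    baseChangeAction μ (x * l ⊗ₜ h) t = l * baseChangeAction μ x (μ h t) := by
  induction x with
  | zero => simp
  | add x y hx hy => simp only [map_add, add_mul, mul_add, LinearMap.add_apply, hx, hy]
  | tmul m g => simp [mul_left_comm, mul_assoc]

/-- Counterpart of `apply_evalMap`: an element acting as γ, multiplied by the γ-twist of `y`, acts
as γ after `y`. It is the source of the crossed identity. -/
lemma baseChangeAction_mul_galoisTensor {γ : L ≃ₐ[k] L} {x : L ⊗[k] H}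
    (hx : ∀ t, baseChangeAction μ x t = γ t) (y : L ⊗[k] H) (t : F) :
    baseChangeAction μ (x * galoisTensor H γ y) t = γ (baseChangeAction μ y t) := by
  induction y with
  | zero => simp
  | add y z hy hz => simp only [map_add, mul_add, LinearMap.add_apply, hy, hz]
  | tmul l h => rw [galoisTensor_tmul, baseChangeAction_mul_tmul, hx]; simp

/-- The bilinear extension of `(x, y) ↦ x(s) y(t)` to `L ⊗_k H`. -/
noncomputable def baseChangePair (s t : F) : (L ⊗[k] H) ⊗[L] (L ⊗[k] H) →ₗ[L] L :=
  LinearMap.mul' L L ∘ₗ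
    TensorProduct.map ((baseChangeAction μ).flip s) ((baseChangeAction μ).flip t)

@[simp]
lemma baseChangePair_tmul (s t : F) (x y : L ⊗[k] H) :
    baseChangePair μ s t (x ⊗ₜ y) = baseChangeAction μ x s * baseChangeAction μ y t := by
  simp [baseChangePair]

variable {μ}

lemma baseChangeAction_apply_mul (hμ : IsModuleAlgebra k F H μ) (x : L ⊗[k] H) (s t : F) :
    baseChangeAction μ x (s * t) = baseChangePair μ s t (Coalgebra.comul (R := L) x) := by
  induction x with
  | zero => simp
  | add x y hx hy => simp only [map_add, LinearMap.add_apply, hx, hy]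
  | tmul l h =>
    rw [baseChangeAction_tmul, hμ.1, TensorProduct.comul_tmul, CommSemiring.comul_apply]
    generalize Coalgebra.comul (R := k) h = z
    induction z with
    | zero => simp
    | add x y hx hy =>
      simp only [map_add, TensorProduct.tmul_add, IntermediateField.coe_add, mul_add, hx, hy]
    | tmul x y => simp [mul_left_comm]

lemma baseChangeAction_apply_one (hμ : IsModuleAlgebra k F H μ) (x : L ⊗[k] H) :
    baseChangeAction μ x 1 = Coalgebra.counit (R := L) x := by
  induction x with
  | zero => simp
  | add x y hx hy => simp only [map_add, LinearMap.add_apply, hx, hy]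
  | tmul l h =>
    rw [baseChangeAction_tmul, hμ.2, TensorProduct.counit_tmul, CommSemiring.counit_apply,
      Algebra.smul_def, mul_comm]
    rfl

lemma baseChangeAction_rTensor (z : F ⊗[k] H) (t : F) :
    baseChangeAction μ (F.val.toLinearMap.rTensor H z) t = (galoisMap k F H μ z t : L) := by
  induction z with
  | zero => simp
  | add x y hx hy =>
    simp only [map_add, LinearMap.add_apply, IntermediateField.coe_add, hx, hy]
  | tmul s h => simp [galoisMap]

variable [FiniteDimensional k F]

lemma baseChangeAction_bijective (hμ : IsHopfGaloisAction k F H μ) :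
    Function.Bijective (baseChangeAction (L := L) μ) := by
  obtain ⟨hfin, -, -, hbij⟩ := hμ
  have hsurj : Function.Surjective (baseChangeAction (L := L) μ) := by
    intro φ
    let b := Module.finBasis k F
    -- Bijectivity of the Galois map provides elements acting as the coordinate functions of `b`;
    -- their L-combinations give every k-linear map F → L.
    choose z hz using fun i =>
      hbij.2 ((LinearMap.toSpanSingleton k F 1).comp (b.coord i))
    refine ⟨∑ i, φ (b i) • F.val.toLinearMap.rTensor H (z i), ?_⟩
    refine b.ext fun j => ?_
    simp only [map_sum, map_smul, LinearMap.sum_apply, LinearMap.smul_apply,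
      baseChangeAction_rTensor, hz]
    rw [Finset.sum_eq_single j]
    · simp
    · intro i _ hij
      simp [hij.symm]
    · simp
  refine ⟨(LinearMap.injective_iff_surjective_of_finrank_eq_finrank ?_).2 hsurj, hsurj⟩
  rw [Module.finrank_baseChange, Module.finrank_linearMap_self]
  have h := (LinearEquiv.ofBijective (galoisMap k F H μ) hbij).finrank_eq
  rw [Module.finrank_tensorProduct, Module.finrank_linearMap] at h
  exact Nat.eq_of_mul_eq_mul_left Module.finrank_pos h

/-- `baseChangeAction` as a linear equivalence. -/
noncomputable def baseChangeEquiv (hμ : IsHopfGaloisAction k F H μ) :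
    L ⊗[k] H ≃ₗ[L] (F →ₗ[k] L) :=
  LinearEquiv.ofBijective _ (baseChangeAction_bijective hμ)

/-- Pairings with basis vectors of `F` are exactly the coordinates in the product of the dual basis
`B` with itself, so they separate tensors. -/
lemma eq_of_baseChangePair_eq (hμ : IsHopfGaloisAction k F H μ)
    {x y : (L ⊗[k] H) ⊗[L] (L ⊗[k] H)}
    (hxy : ∀ s t, baseChangePair μ s t x = baseChangePair μ s t y) : x = y := by
  classical
  let b := Module.finBasis k F
  let B : Module.Basis _ L (L ⊗[k] H) :=
    (Pi.basisFun L _).map ((b.constr L).trans (baseChangeEquiv hμ).symm)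
  have hB : ∀ i j, baseChangeAction μ (B i) (b j) = if i = j then 1 else 0 := by
    intro i j
    have h1 : baseChangeAction μ (B i) = b.constr L (Pi.basisFun L _ i) :=
      (baseChangeEquiv hμ).apply_symm_apply _
    rw [h1, Module.Basis.constr_basis]
    simp [Pi.single_apply, eq_comm]
  have hcoord : ∀ i j, (B.tensorProduct B).coord (i, j) = baseChangePair μ (b i) (b j) := by
    intro i j
    refine (B.tensorProduct B).ext fun p => ?_
    obtain ⟨p, q⟩ := p
    rw [Module.Basis.coord_apply, Module.Basis.repr_self, Module.Basis.tensorProduct_apply,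
      baseChangePair_tmul, hB, hB, Finsupp.single_apply]
    by_cases hp : p = i <;> by_cases hq : q = j <;> simp [hp, hq]
  refine (B.tensorProduct B).ext_elem fun p => ?_
  obtain ⟨p, q⟩ := p
  rw [← Module.Basis.coord_apply, ← Module.Basis.coord_apply, hcoord]
  exact hxy _ _

lemma isGroupLikeElem_of_mul (hμ : IsHopfGaloisAction k F H μ) {x : L ⊗[k] H}
    (h1 : baseChangeAction μ x 1 = 1)
    (hmul : ∀ s t, baseChangeAction μ x (s * t) =
      baseChangeAction μ x s * baseChangeAction μ x t) : IsGroupLikeElem L x where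
  counit_eq_one := by rw [← baseChangeAction_apply_one hμ.2.2.1, h1]
  comul_eq_tmul_self := eq_of_baseChangePair_eq hμ fun s t => by
    rw [← baseChangeAction_apply_mul hμ.2.2.1, baseChangePair_tmul, hmul]

/-- The group-like element acting as the restriction of `γ` to `F`. -/
noncomputable def groupLikeOf (hμ : IsHopfGaloisAction k F H μ) (γ : L ≃ₐ[k] L) :
    GroupLike L (L ⊗[k] H) :=
  ⟨(baseChangeEquiv hμ).symm (γ.toLinearMap ∘ₗ F.val.toLinearMap), by
    have h : ∀ t, baseChangeAction μ ((baseChangeEquiv hμ).symm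
        (γ.toLinearMap ∘ₗ F.val.toLinearMap)) t = γ t := fun t =>
      DFunLike.congr_fun ((baseChangeEquiv hμ).apply_symm_apply _) t
    exact isGroupLikeElem_of_mul hμ (by rw [h]; simp) (fun s t => by rw [h, h, h]; simp)⟩

lemma baseChangeAction_groupLikeOf (hμ : IsHopfGaloisAction k F H μ) (γ : L ≃ₐ[k] L) (t : F) :
    baseChangeAction μ (groupLikeOf hμ γ).val t = γ t :=
  DFunLike.congr_fun ((baseChangeEquiv hμ).apply_symm_apply _) t

lemma groupLikeOf_mul_val (hμ : IsHopfGaloisAction k F H μ) (γ δ : L ≃ₐ[k] L) :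
    (groupLikeOf hμ (γ * δ)).val =
      (groupLikeOf hμ γ).val * galoisTensor H γ (groupLikeOf hμ δ).val := by
  apply (baseChangeAction_bijective hμ).1
  ext t
  rw [baseChangeAction_mul_galoisTensor μ (baseChangeAction_groupLikeOf hμ γ),
    baseChangeAction_groupLikeOf, baseChangeAction_groupLikeOf]
  rfl

/-- A group-like element acts as an algebra map F → L, which normality extends to an automorphism of
`L`. -/
lemma groupLikeOf_surjective [Normal k L] (hμ : IsHopfGaloisAction k F H μ) :
    Function.Surjective (groupLikeOf hμ) := by
  intro x
  let φ : F →ₐ[k] L := AlgHom.ofLinearMap (baseChangeAction μ x.val)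
    (by rw [baseChangeAction_apply_one hμ.2.2.1, x.2.counit_eq_one])
    (fun s t => by
      rw [baseChangeAction_apply_mul hμ.2.2.1, x.2.comul_eq_tmul_self, baseChangePair_tmul])
  let γ : L ≃ₐ[k] L := AlgEquiv.ofBijective (φ.liftNormal L) (AlgHom.normal_bijective k L L _)
  refine ⟨γ, GroupLike.val_injective ?_⟩
  apply (baseChangeAction_bijective hμ).1
  ext t
  rw [baseChangeAction_groupLikeOf]
  exact φ.liftNormal_commutes L t

/-- Since every group-like element comes from some δ, the crossed identity writes its γ-twist as a
quotient of two group-like elements. -/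
lemma isGroupLikeElem_galoisTensor [Normal k L] (hμ : IsHopfGaloisAction k F H μ)
    (γ : L ≃ₐ[k] L) (x : GroupLike L (L ⊗[k] H)) :
    IsGroupLikeElem L (galoisTensor H γ x.val) := by
  obtain ⟨δ, rfl⟩ := groupLikeOf_surjective hμ x
  have h : galoisTensor H γ (groupLikeOf hμ δ).val =
      ((groupLikeOf hμ γ)⁻¹ * groupLikeOf hμ (γ * δ)).val := by
    rw [GroupLike.val_mul, groupLikeOf_mul_val, ← mul_assoc, ← GroupLike.val_mul,
      inv_mul_cancel, GroupLike.val_one, one_mul]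
  rw [h]
  exact GroupLike.isGroupLikeElem_val _

/-- The action of the Galois group on the group-like elements of `L ⊗_k H`. -/
noncomputable def groupLikeAction [Normal k L] (hμ : IsHopfGaloisAction k F H μ) :
    (L ≃ₐ[k] L) →* MulAut (GroupLike L (L ⊗[k] H)) where
  toFun γ :=
    { toFun := fun x => ⟨galoisTensor H γ x.val, isGroupLikeElem_galoisTensor hμ γ x⟩
      invFun := fun x => ⟨galoisTensor H γ⁻¹ x.val, isGroupLikeElem_galoisTensor hμ γ⁻¹ x⟩
      left_inv := fun x => GroupLike.val_injective (by
        change galoisTensor H γ⁻¹ (galoisTensor H γ x.val) = x.val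
        rw [← galoisTensor_mul, inv_mul_cancel, galoisTensor_one])
      right_inv := fun x => GroupLike.val_injective (by
        change galoisTensor H γ (galoisTensor H γ⁻¹ x.val) = x.val
        rw [← galoisTensor_mul, mul_inv_cancel, galoisTensor_one])
      map_mul' := fun x y => GroupLike.val_injective (map_mul (galoisTensor H γ) _ _) }
  map_one' := MulEquiv.ext fun x => GroupLike.val_injective (galoisTensor_one _)
  map_mul' γ δ := MulEquiv.ext fun x => GroupLike.val_injective (galoisTensor_mul γ δ _)

lemma isCrossedParam_groupLikeOf [Normal k L] (hμ : IsHopfGaloisAction k F H μ) :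
    IsCrossedParam F.fixingSubgroup (groupLikeAction hμ) (groupLikeOf hμ) where
  surjective := groupLikeOf_surjective hμ
  map_mul γ δ := GroupLike.val_injective (groupLikeOf_mul_val hμ γ δ)
  eq_one_iff γ := by
    rw [← GroupLike.val_inj, ← (baseChangeAction_bijective hμ).1.eq_iff, LinearMap.ext_iff,
      IntermediateField.mem_fixingSubgroup_iff]
    simp_rw [GroupLike.val_one, baseChangeAction_one, baseChangeAction_groupLikeOf]
    exact ⟨fun h t ht => h ⟨t, ht⟩, fun h t => h t t.2⟩

omit [FiniteDimensional k F] in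
/-- A Hopf Galois structure on a subextension `F/k` of a normal extension `L/k` yields a crossed
homomorphism which identifies `Gal(L/k)/Gal(L/F)` with a group. -/
theorem exists_isCrossedParam_of_isHopfGalois [Normal k L] (h : IsHopfGalois k F) :
    ∃ (N : Type v) (_ : Group N) (θ : (L ≃ₐ[k] L) →* MulAut N) (f : (L ≃ₐ[k] L) → N),
      IsCrossedParam F.fixingSubgroup θ f := by
  obtain ⟨hfin, H, _, _, μ, hμ⟩ := h
  exact ⟨_, _, _, _, isCrossedParam_groupLikeOf hμ⟩

end Converse

/-! ### The group `F₃₆` -/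

lemma quarterTurn_sq : quarterTurn ^ 2 = inversion :=
  MulEquiv.ext fun _ => rfl

lemma inversion_sq : inversion ^ 2 = 1 :=
  MulEquiv.ext fun v => inv_inv v

lemma orderOf_quarterTurn : orderOf quarterTurn = 4 := by
  refine orderOf_eq_prime_pow (p := 2) (n := 1) ?_ ?_
  · intro h
    have h1 := DFunLike.congr_fun h (Multiplicative.ofAdd (1, 0))
    revert h1
    decide
  · rw [pow_succ 2 1, pow_one, pow_mul, quarterTurn_sq, inversion_sq]

lemma eq_of_mem_zpowers_quarterTurn {ρ : MulAut C3xC3} (h : ρ ∈ Subgroup.zpowers quarterTurn) :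
    ρ = 1 ∨ ρ = quarterTurn ∨ ρ = inversion ∨ ρ = quarterTurn * inversion := by
  have hfin : IsOfFinOrder quarterTurn :=
    orderOf_pos_iff.1 (by rw [orderOf_quarterTurn]; norm_num)
  classical
  obtain ⟨n, hn, rfl⟩ := (hfin.mem_zpowers_iff_mem_range_orderOf.1 h) |> Finset.mem_image.1
  rw [orderOf_quarterTurn, Finset.mem_range] at hn
  interval_cases n
  · exact Or.inl (pow_zero _)
  · exact Or.inr (Or.inl (pow_one _))
  · exact Or.inr (Or.inr (Or.inl quarterTurn_sq))
  · refine Or.inr (Or.inr (Or.inr ?_))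
    rw [pow_succ', quarterTurn_sq]

lemma eq_of_mem_zpowers_inversion {ρ : MulAut C3xC3} (h : ρ ∈ Subgroup.zpowers inversion) :
    ρ = 1 ∨ ρ = inversion := by
  obtain ⟨n, rfl⟩ := h
  rcases Int.even_or_odd' n with ⟨m, rfl | rfl⟩
  · left
    simp [zpow_mul, show inversion ^ (2 : ℤ) = 1 from inversion_sq]
  · right
    simp [zpow_add, zpow_mul, show inversion ^ (2 : ℤ) = 1 from inversion_sq]

lemma sq_mem_zpowers_inversion {ρ : MulAut C3xC3} (h : ρ ∈ Subgroup.zpowers quarterTurn) :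
    ρ ^ 2 ∈ Subgroup.zpowers inversion := by
  obtain ⟨n, rfl⟩ := h
  refine ⟨n, ?_⟩
  change inversion ^ n = (quarterTurn ^ n) ^ 2
  rw [← quarterTurn_sq, ← zpow_natCast, ← zpow_natCast, ← zpow_mul, ← zpow_mul, mul_comm]

lemma inversion_ne_one : inversion ≠ 1 := by
  intro h
  have h1 := orderOf_dvd_of_pow_eq_one (quarterTurn_sq.trans h)
  rw [orderOf_quarterTurn] at h1
  omega

lemma quarterTurn_mul_inversion_sq : (quarterTurn * inversion) ^ 2 = inversion := by
  rw [← quarterTurn_sq, ← pow_succ', ← pow_mul, show 3 * 2 = 4 + 2 from rfl, pow_add,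
    ← orderOf_quarterTurn, pow_orderOf_eq_one, one_mul]

/-- A power of the quarter turn preserves the line through `v ≠ 1` if and only if its square is
trivial. -/
lemma apply_mem_line_iff {ρ : MulAut C3xC3} (h : ρ ∈ Subgroup.zpowers quarterTurn) {v : C3xC3}
    (hv : v ≠ 1) : (ρ v = 1 ∨ ρ v = v ∨ ρ v = v ^ 2) ↔ ρ ^ 2 = 1 := by
  -- As -1 is not a square modulo 3, the quarter turn has no eigenline.
  have hq : ∀ v : C3xC3, v ≠ 1 → ¬ (quarterTurn v = 1 ∨ quarterTurn v = v ∨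
      quarterTurn v = v ^ 2) := by decide
  have hq' : ∀ v : C3xC3, v ≠ 1 → ¬ (quarterTurn v⁻¹ = 1 ∨ quarterTurn v⁻¹ = v ∨
      quarterTurn v⁻¹ = v ^ 2) := by decide
  have hi : ∀ v : C3xC3, v⁻¹ = v ^ 2 := by decide
  rcases eq_of_mem_zpowers_quarterTurn h with rfl | rfl | rfl | rfl
  · simp
  · rw [quarterTurn_sq]
    exact iff_of_false (hq v hv) inversion_ne_one
  · rw [inversion_sq]
    exact iff_of_true (Or.inr (Or.inr (hi v))) rfl
  · rw [quarterTurn_mul_inversion_sq]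
    exact iff_of_false (hq' v hv) inversion_ne_one

lemma card_C3xC3 : Nat.card C3xC3 = 9 := by
  rw [Nat.card_eq_fintype_card]
  rfl

lemma card_F36 : Nat.card F36 = 36 := by
  rw [SemidirectProduct.card, card_C3xC3, Nat.card_zpowers, orderOf_quarterTurn]

/-- The elements of `F₃₆` whose image in `C₄` has trivial square. -/
lemma card_right_sq_eq_one : Nat.card {g : F36 // g.right ^ 2 = 1} = 18 := by
  have hfin : IsOfFinOrder quarterTurn :=
    orderOf_pos_iff.1 (by rw [orderOf_quarterTurn]; norm_num)
  have h1 : Nat.card {ρ : Subgroup.zpowers quarterTurn // ρ ^ 2 = 1} = 2 := by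
    have e : {j : Fin 4 // j.val % 2 = 0} ≃ {ρ : Subgroup.zpowers quarterTurn // ρ ^ 2 = 1} := by
      refine ((finCongr orderOf_quarterTurn.symm).trans (finEquivZPowers hfin)).subtypeEquiv ?_
      intro j
      rw [Equiv.trans_apply, finEquivZPowers_apply, Subtype.ext_iff]
      change _ ↔ (quarterTurn ^ (j : ℕ)) ^ 2 = 1
      rw [← pow_mul, ← orderOf_dvd_iff_pow_eq_one, orderOf_quarterTurn]
      omega
    rw [← Nat.card_congr e, Nat.card_eq_fintype_card]
    rfl
  have e : {g : F36 // g.right ^ 2 = 1} ≃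
      C3xC3 × {ρ : Subgroup.zpowers quarterTurn // ρ ^ 2 = 1} :=
    { toFun := fun g => (g.1.left, ⟨g.1.right, g.2⟩)
      invFun := fun p => ⟨⟨p.1, p.2.1⟩, p.2.2⟩
      left_inv := fun _ => rfl
      right_inv := fun _ => rfl }
  rw [Nat.card_congr e, Nat.card_prod, card_C3xC3, h1]

/-- The sum over `C₃ × C₃` of a function which is invariant under the quarter turn. -/
lemma exists_sum_eq_of_quarterTurn_invariant {φ : C3xC3 → ℕ} (hφ : ∀ v, φ (quarterTurn v) = φ v)
    {s : C3xC3} (hs : s ≠ 1) : ∃ r, ∑ v, φ v = φ 1 + 4 * φ s + 4 * φ r := by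
  let u : ZMod 3 → ZMod 3 → C3xC3 := fun a b => Multiplicative.ofAdd (a, b)
  have hu : ∀ a b, φ (u (-b) a) = φ (u a b) := fun a b => hφ (u a b)
  have hsum : ∑ v, φ v = ∑ a : ZMod 3, ∑ b : ZMod 3, φ (u a b) :=
    Fintype.sum_prod_type (f := fun p : ZMod 3 × ZMod 3 => φ (Multiplicative.ofAdd p))
  -- These relations express that the quarter turn has two orbits of size 4 off the origin,
  -- represented by (1,0) and (1,1).
  have h1 : φ (u 0 1) = φ (u 1 0) := hu 1 0
  have h2 : φ (u 2 0) = φ (u 0 1) := hu 0 1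
  have h3 : φ (u 0 2) = φ (u 2 0) := hu 2 0
  have h4 : φ (u 2 1) = φ (u 1 1) := hu 1 1
  have h5 : φ (u 2 2) = φ (u 2 1) := hu 2 1
  have h6 : φ (u 1 2) = φ (u 2 2) := hu 2 2
  have h7 : ∑ v, φ v = φ (u 0 0) + 4 * φ (u 1 0) + 4 * φ (u 1 1) := by
    rw [hsum]
    change ∑ a : Fin 3, ∑ b : Fin 3, φ (u a b) = _
    simp only [Fin.sum_univ_three]
    change φ (u 0 0) + φ (u 0 1) + φ (u 0 2) + (φ (u 1 0) + φ (u 1 1) + φ (u 1 2)) +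
      (φ (u 2 0) + φ (u 2 1) + φ (u 2 2)) = _
    omega
  have h8 : ∀ s : C3xC3, s ≠ 1 → (s = u 1 0 ∨ s = u 0 1 ∨ s = u 2 0 ∨ s = u 0 2) ∨
      (s = u 1 1 ∨ s = u 2 1 ∨ s = u 2 2 ∨ s = u 1 2) := by decide
  have h9 : φ (u 0 0) = φ 1 := rfl
  rcases h8 s hs with h | h
  · refine ⟨u 1 1, ?_⟩
    rcases h with rfl | rfl | rfl | rfl <;> omega
  · refine ⟨u 1 0, ?_⟩
    rcases h with rfl | rfl | rfl | rfl <;> omega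

/-! ### Crossed homomorphisms whose fibre over `1` has order 3 -/

section FixedPoints

variable {G N : Type*} [Group G] [Group N] {θ : G →* MulAut N} {f : G → N} {G' : Subgroup G}

/-- The subgroup of fixed points of `g` acting on `N`. -/
def fixedSubgroup (θ : G →* MulAut N) (g : G) : Subgroup N :=
  (θ g).toMonoidHom.eqLocus (MonoidHom.id N)

lemma mem_fixedSubgroup {g : G} {n : N} : n ∈ fixedSubgroup θ g ↔ θ g n = n := Iff.rfl

lemma card_fixedSubgroup_conj (g c : G) :
    Nat.card (fixedSubgroup θ (c * g * c⁻¹)) = Nat.card (fixedSubgroup θ g) := by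
  symm
  refine Nat.card_congr ((θ c).toEquiv.subtypeEquiv fun n => ?_)
  change θ g n = n ↔ θ (c * g * c⁻¹) (θ c n) = θ c n
  rw [← MulAut.mul_apply, ← map_mul, inv_mul_cancel_right, map_mul, MulAut.mul_apply,
    (θ c).injective.eq_iff]

/-- Under a crossed parametrization, the fixed points of `s ∈ G'` acting on `N` correspond to the
fixed points of `s` acting on `G/G'`. -/
lemma IsCrossedParam.card_fixedSubgroup_mul [Finite G] (hf : IsCrossedParam G' θ f) {s : G}
    (hs : s ∈ G') :
    Nat.card (fixedSubgroup θ s) * Nat.card G' = Nat.card {γ : G // γ⁻¹ * s * γ ∈ G'} := by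
  have hmem : ∀ γ, f γ ∈ fixedSubgroup θ s ↔ γ⁻¹ * s * γ ∈ G' := by
    -- Because f(s) = 1, the crossed identity reads θ_s(f(γ)) = f(sγ): acting by θ_s on N is left
    -- translation by s on cosets.
    intro γ
    have h1 : θ s (f γ) = f (s * γ) := by rw [hf.map_mul, (hf.eq_one_iff s).2 hs, one_mul]
    rw [mem_fixedSubgroup, h1, eq_comm, hf.eq_iff, mul_assoc]
  choose σ hσ using hf.surjective
  rw [← Nat.card_prod]
  refine Nat.card_congr
    { toFun := fun p => ⟨σ p.1 * p.2, by
        rw [← hmem, hf.map_mul, hσ, (hf.eq_one_iff _).2 p.2.2, _root_.map_one, mul_one]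
        exact p.1.2⟩
      invFun := fun γ => (⟨f γ, (hmem γ).2 γ.2⟩, ⟨(σ (f γ))⁻¹ * γ, by
        rw [← hf.eq_iff, hσ]⟩)
      left_inv := ?_
      right_inv := fun γ => Subtype.ext (mul_inv_cancel_left _ _) }
  rintro ⟨⟨n, hn⟩, ⟨g, hg⟩⟩
  have h1 : f (σ n * g) = n := by
    rw [hf.map_mul, hσ, (hf.eq_one_iff _).2 hg, _root_.map_one, mul_one]
  simp [h1]

/-- Burnside's lemma for the action of a group on `N` through `θ`. -/
lemma card_dvd_sum_card_fixedSubgroup [Finite N] {V : Type*} [Group V] [Fintype V] (ι : V →* G) :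
    Fintype.card V ∣ ∑ v, Nat.card (fixedSubgroup θ (ι v)) := by
  classical
  let : MulAction V N := MulAction.compHom N (θ.comp ι)
  have : Fintype N := Fintype.ofFinite N
  have : Fintype (MulAction.orbitRel.Quotient V N) := Fintype.ofFinite _
  have h := MulAction.sum_card_fixedBy_eq_card_orbits_mul_card_group V N
  have h1 : ∑ v : V, Nat.card (fixedSubgroup θ (ι v)) =
      ∑ v : V, Fintype.card (MulAction.fixedBy N v) := by
    refine Finset.sum_congr rfl fun v _ => ?_
    rw [← Nat.card_eq_fintype_card]
    rfl
  rw [h1, h]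
  exact dvd_mul_left _ _

end FixedPoints

/-! ### Subgroups of order 3 in F₃₆ and the fixed-point count -/

section F36

variable {G : Type*} [Group G] (e : G ≃* F36)

/-- The embedding of `C₃ × C₃` in a group isomorphic to `F₃₆`. -/
def translation : C3xC3 →* G := e.symm.toMonoidHom.comp SemidirectProduct.inl

@[simp]
lemma apply_translation (v : C3xC3) : e (translation e v) = SemidirectProduct.inl v :=
  e.apply_symm_apply _

lemma translation_injective : Function.Injective (translation e) :=
  e.symm.injective.comp SemidirectProduct.inl_injective

lemma inv_mul_translation_mul (γ : G) (v : C3xC3) :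
    γ⁻¹ * translation e v * γ =
      translation e (((e γ).right⁻¹ : Subgroup.zpowers quarterTurn).1 v) := by
  apply e.injective
  rw [map_mul, map_mul, map_inv, apply_translation, apply_translation]
  ext <;> simp [mul_comm]

lemma conj_translation (v : C3xC3) :
    ∃ c : G, c * translation e v * c⁻¹ = translation e (quarterTurn v) := by
  refine ⟨(e.symm (SemidirectProduct.inr ⟨quarterTurn, Subgroup.mem_zpowers _⟩))⁻¹⁻¹, ?_⟩
  have h := inv_mul_translation_mul e
    (e.symm (SemidirectProduct.inr ⟨quarterTurn, Subgroup.mem_zpowers _⟩))⁻¹ v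
  rw [inv_inv] at h ⊢
  rw [h]
  simp

lemma exists_translation_of_card_eq_three {G' : Subgroup G} (hG' : Nat.card G' = 3) :
    ∃ s : C3xC3, s ≠ 1 ∧
      ∀ v, translation e v ∈ G' ↔ (v = 1 ∨ v = s ∨ v = s ^ 2) := by
  have : Fact (Nat.Prime 3) := ⟨Nat.prime_three⟩
  have hcyc : IsCyclic G' := isCyclic_of_prime_card hG'
  obtain ⟨⟨g, hg⟩, hgen⟩ := hcyc.exists_generator
  have hord : orderOf g = 3 := by
    have h := orderOf_eq_card_of_forall_mem_zpowers hgen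
    rw [hG', Subgroup.orderOf_mk] at h
    exact h
  have hz : G' = Subgroup.zpowers g := by
    ext x
    constructor
    · intro hx
      obtain ⟨n, hn⟩ := hgen ⟨x, hx⟩
      exact ⟨n, congrArg Subtype.val hn⟩
    · rintro ⟨n, rfl⟩
      exact zpow_mem hg n
  have hg3 : g ^ 3 = 1 := hord ▸ pow_orderOf_eq_one g
  -- An element of order 3 has trivial image in C₄, because 3 and 4 are coprime.
  have hρ : (e g).right = 1 := by
    have h3 : (e g).right ^ 3 = 1 := by
      rw [← SemidirectProduct.rightHom_eq_right, ← map_pow, ← map_pow, hg3, map_one, map_one]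
    have h4 : (e g).right ^ 4 = 1 := by
      rw [← orderOf_quarterTurn, ← Nat.card_zpowers, pow_card_eq_one']
    rw [pow_succ, h3, one_mul] at h4
    exact h4
  have hs : translation e (e g).left = g := by
    apply e.injective
    rw [apply_translation]
    ext <;> simp [hρ]
  refine ⟨(e g).left, ?_, ?_⟩
  · intro h
    rw [h, map_one] at hs
    rw [← hs, orderOf_one] at hord
    omega
  · intro v
    rw [hz]
    constructor
    · intro hv
      classical
      have hfin : IsOfFinOrder g := orderOf_pos_iff.1 (by omega)
      obtain ⟨n, hn, hnv⟩ := Finset.mem_image.1 (hfin.mem_zpowers_iff_mem_range_orderOf.1 hv)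
      rw [hord, Finset.mem_range] at hn
      rw [← hs, ← map_pow] at hnv
      have := translation_injective e hnv
      subst this
      interval_cases n <;> simp
    · rintro (rfl | rfl | rfl)
      · rw [map_one]; exact one_mem _
      · rw [hs]; exact Subgroup.mem_zpowers g
      · rw [map_pow, hs]; exact pow_mem (Subgroup.mem_zpowers g) 2

include e in
/-- In a group isomorphic to `F₃₆` no subgroup of order 3 is the fibre over `1` of a surjective
crossed homomorphism. -/
theorem not_isCrossedParam_of_card_eq_three {G' : Subgroup G} (hG' : Nat.card G' = 3)
    {N : Type*} [Group N] {θ : G →* MulAut N} {f : G → N} : ¬ IsCrossedParam G' θ f := by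
  intro hf
  have hcardG : Nat.card G = 36 := (Nat.card_congr e.toEquiv).trans card_F36
  have hfinG : Finite G := Nat.finite_of_card_ne_zero (by omega)
  have hfinN : Finite N := Finite.of_surjective f hf.surjective
  have hcardN : Nat.card N = 12 := by
    have h := G'.index_mul_card
    rw [hG', hcardG] at h
    rw [hf.card_eq_index]
    omega
  obtain ⟨s, hs1, hs⟩ := exists_translation_of_card_eq_three e hG'
  have hfix : Nat.card (fixedSubgroup θ (translation e s)) = 6 := by
    have h := hf.card_fixedSubgroup_mul ((hs s).2 (Or.inr (Or.inl rfl)))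
    -- Conjugation acts on translations through C₄, and only ±1 preserves the line of `s`: this
    -- leaves 9·2 elements.
    have h18 : Nat.card {γ : G // γ⁻¹ * translation e s * γ ∈ G'} = 18 := by
      rw [← card_right_sq_eq_one]
      refine Nat.card_congr (e.toEquiv.subtypeEquiv fun γ => ?_)
      rw [inv_mul_translation_mul, hs, apply_mem_line_iff ((e γ).right⁻¹).2 hs1]
      change _ ↔ (e γ).right ^ 2 = 1
      rw [← Subgroup.coe_pow, OneMemClass.coe_eq_one, inv_pow, inv_eq_one]
    rw [hG', h18] at h
    omega
  obtain ⟨r, hr⟩ := exists_sum_eq_of_quarterTurn_invariant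
    (φ := fun v => Nat.card (fixedSubgroup θ (translation e v))) (fun v => by
      obtain ⟨c, hc⟩ := conj_translation e v
      rw [← hc, card_fixedSubgroup_conj]) hs1
  have hone : Nat.card (fixedSubgroup θ (translation e 1)) = 12 := by
    have h : fixedSubgroup θ (translation e 1) = ⊤ := by
      ext n
      simp [mem_fixedSubgroup]
    rw [h, Subgroup.card_top, hcardN]
  have hdvd := card_dvd_sum_card_fixedSubgroup (θ := θ) (translation e)
  rw [hr, ← Nat.card_eq_fintype_card, card_C3xC3] at hdvd
  have hr12 := Subgroup.card_subgroup_dvd_card (fixedSubgroup θ (translation e r))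
  rw [hcardN] at hr12
  have hle := Nat.le_of_dvd (by norm_num) hr12
  rw [hfix, hone] at hdvd
  generalize Nat.card (fixedSubgroup θ (translation e r)) = x at *
  -- Divisibility of 12 + 24 + 4x by 9 would force 9 ∣ x, which is incompatible with x ∣ 12.
  interval_cases x <;> omega

end F36

/-! ### The regular subgroup of type `SmallGroup(18,4)` -/

/-- Inversion is central in the automorphism group of C₃ × C₃, which is what lets `extendAut` keep
the C₂-part fixed. -/
lemma mul_comm_of_mem_zpowers_inversion {ρ j : MulAut C3xC3}
    (hj : j ∈ Subgroup.zpowers inversion) (v : C3xC3) : ρ (j v) = j (ρ v) := by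
  rcases eq_of_mem_zpowers_inversion hj with rfl | rfl
  · rfl
  · exact map_inv ρ v

/-- The automorphism of `SmallGroup(18,4)` induced by an automorphism of `C₃ × C₃`. -/
def extendAut : MulAut C3xC3 →* MulAut SmallGroup18_4 where
  toFun ρ :=
    { toFun := fun x => ⟨ρ x.left, x.right⟩
      invFun := fun x => ⟨ρ⁻¹ x.left, x.right⟩
      left_inv := fun x => SemidirectProduct.ext (ρ.symm_apply_apply _) rfl
      right_inv := fun x => SemidirectProduct.ext (ρ.apply_symm_apply _) rfl
      map_mul' := fun x y => SemidirectProduct.ext (by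
        change ρ (x.left * x.right.1 y.left) = ρ x.left * x.right.1 (ρ y.left)
        rw [map_mul, mul_comm_of_mem_zpowers_inversion x.right.2]) rfl }
  map_one' := rfl
  map_mul' _ _ := rfl

lemma extendAut_inl (ρ : MulAut C3xC3) (v : C3xC3) :
    extendAut ρ (SemidirectProduct.inl v) = SemidirectProduct.inl (ρ v) := rfl

lemma extendAut_inr (ρ : MulAut C3xC3) (j : Subgroup.zpowers inversion) :
    extendAut ρ (SemidirectProduct.inr j) = SemidirectProduct.inr j :=
  SemidirectProduct.ext (map_one ρ) rfl

/-- The action of `F₃₆` on `SmallGroup(18,4)` by conjugation in the holomorph of `C₃ × C₃`. -/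
def holomorphAction : F36 →* MulAut SmallGroup18_4 :=
  SemidirectProduct.lift (MulAut.conj.comp SemidirectProduct.inl)
    (extendAut.comp (Subgroup.zpowers quarterTurn).subtype) fun ρ => by
      refine MonoidHom.ext fun v => ?_
      refine MulEquiv.ext fun x => ?_
      change SemidirectProduct.inl (ρ.1 v) * x * (SemidirectProduct.inl (ρ.1 v))⁻¹ =
        extendAut ρ.1 (SemidirectProduct.inl v * (extendAut ρ.1)⁻¹ x *
          (SemidirectProduct.inl v)⁻¹)
      rw [map_mul, map_mul, map_inv, extendAut_inl, MulAut.apply_inv_self]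

lemma holomorphAction_apply (γ : F36) (x : SmallGroup18_4) :
    holomorphAction γ x = SemidirectProduct.inl γ.left * extendAut γ.right.1 x *
      (SemidirectProduct.inl γ.left)⁻¹ := rfl

/-- Squaring, as a map from `C₄` to `C₂`. -/
def sqRight (γ : F36) : Subgroup.zpowers inversion :=
  ⟨γ.right.1 ^ 2, sq_mem_zpowers_inversion γ.right.2⟩

/-- C₄ is abelian; the reversed order matches the order of factors in `crossedMap_mul`. -/
lemma sqRight_mul (γ δ : F36) : sqRight (γ * δ) = sqRight δ * sqRight γ := by
  apply Subtype.ext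
  change ((γ.right * δ.right : Subgroup.zpowers quarterTurn) : MulAut C3xC3) ^ 2 =
    δ.right.1 ^ 2 * γ.right.1 ^ 2
  obtain ⟨m, hm⟩ := γ.right.2
  obtain ⟨n, hn⟩ := δ.right.2
  rw [Subgroup.coe_mul, ← hm, ← hn]
  simp only [← zpow_add, ← zpow_natCast, ← zpow_mul]
  congr 1
  ring

/-- The inverse of a crossed homomorphism `F₃₆ → SmallGroup(18,4)`. -/
def crossedMap (u : C3xC3) (γ : F36) : SmallGroup18_4 :=
  SemidirectProduct.inl (γ.left * γ.right.1 u) * SemidirectProduct.inr (sqRight γ) *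
    (SemidirectProduct.inl u)⁻¹

/-- View F₃₆ as affine maps of C₃ × C₃. Then `crossedMap u γ` takes `u` to γ(u) and has linear part
ρ², with ρ the linear part of γ. Conjugating `crossedMap u δ` by γ gives a map from γ(u) to γδ(u),
which composes with `crossedMap u γ`. Passing to inverses later restores the usual order of factors.
-/
lemma crossedMap_mul (u : C3xC3) (γ δ : F36) :
    crossedMap u (γ * δ) = holomorphAction γ (crossedMap u δ) * crossedMap u γ := by
  rw [holomorphAction_apply]
  simp only [crossedMap, map_mul, map_inv, extendAut_inl, extendAut_inr, sqRight_mul]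
  have h1 : (γ * δ).left = γ.left * γ.right.1 δ.left := rfl
  have h2 : (γ * δ).right.1 u = γ.right.1 (δ.right.1 u) := rfl
  rw [h1, h2]
  simp only [map_mul]
  group

lemma crossedMap_left (u : C3xC3) (γ : F36) :
    (crossedMap u γ).left = γ.left * γ.right.1 u * (γ.right.1 ^ 2) u⁻¹ := by
  simp [crossedMap, sqRight]

lemma crossedMap_right (u : C3xC3) (γ : F36) : (crossedMap u γ).right = sqRight γ := by
  simp [crossedMap]

lemma crossedMap_surjective (u : C3xC3) : Function.Surjective (crossedMap u) := by
  rintro ⟨w, j⟩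
  -- Squaring maps C₄ onto C₂; once ρ is chosen, the translation part is solved for freely.
  have h : ∃ ρ : Subgroup.zpowers quarterTurn, ρ.1 ^ 2 = j.1 := by
    rcases eq_of_mem_zpowers_inversion j.2 with h | h
    · exact ⟨1, by rw [h]; rfl⟩
    · exact ⟨⟨quarterTurn, Subgroup.mem_zpowers _⟩, by rw [h, quarterTurn_sq]⟩
  obtain ⟨ρ, hρ⟩ := h
  refine ⟨⟨w * ((ρ.1 ^ 2) u⁻¹)⁻¹ * (ρ.1 u)⁻¹, ρ⟩, SemidirectProduct.ext ?_ ?_⟩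
  · rw [crossedMap_left]
    simp
  · rw [crossedMap_right]
    exact Subtype.ext hρ

/-- The involution of `F₃₆` with translation part `v`. -/
def involution (v : C3xC3) : F36 :=
  ⟨v, ⟨inversion, 2, quarterTurn_sq⟩⟩

lemma eq_of_right_sq_eq_one {γ : F36} (h : γ.right.1 ^ 2 = 1) :
    γ = SemidirectProduct.inl γ.left ∨ γ = involution γ.left := by
  rcases eq_of_mem_zpowers_quarterTurn γ.right.2 with h1 | h1 | h1 | h1
  · exact Or.inl (SemidirectProduct.ext rfl (Subtype.ext h1))
  · rw [h1, quarterTurn_sq] at h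
    exact absurd h inversion_ne_one
  · exact Or.inr (SemidirectProduct.ext rfl (Subtype.ext h1))
  · rw [h1, quarterTurn_mul_inversion_sq] at h
    exact absurd h inversion_ne_one

/-- The base point `v⁻¹` is the centre of the reflection x ↦ v - x, since 2·(-v) = v modulo 3.
Triviality means that γ fixes this centre and has linear part ±1. -/
lemma crossedMap_eq_one_iff (v : C3xC3) (γ : F36) :
    crossedMap v⁻¹ γ = 1 ↔ γ = 1 ∨ γ = involution v := by
  have hi : ∀ v w : C3xC3, w * v * v = 1 ↔ w = v := by decide
  constructor
  · intro h
    have hr : γ.right.1 ^ 2 = 1 := by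
      have h1 : (crossedMap v⁻¹ γ).right = 1 := by rw [h]; rfl
      rw [crossedMap_right] at h1
      exact congrArg Subtype.val h1
    have hl := congrArg SemidirectProduct.left h
    rw [crossedMap_left] at hl
    rcases eq_of_right_sq_eq_one hr with h1 | h1
    · left
      rw [h1] at hl
      simp at hl
      rw [h1, hl, map_one]
    · right
      rw [hr, h1] at hl
      change γ.left * (v⁻¹)⁻¹ * (v⁻¹)⁻¹ = 1 at hl
      rw [inv_inv, hi] at hl
      rw [h1, hl]
  · rintro (rfl | rfl)
    · refine SemidirectProduct.ext ?_ ?_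
      · rw [crossedMap_left]
        simp
      · rw [crossedMap_right]
        exact Subtype.ext (one_pow 2)
    · refine SemidirectProduct.ext ?_ ?_
      · rw [crossedMap_left]
        change v * (v⁻¹)⁻¹ * (inversion ^ 2) (v⁻¹)⁻¹ = 1
        rw [inversion_sq, inv_inv]
        exact (hi v v).2 rfl
      · rw [crossedMap_right]
        exact Subtype.ext inversion_sq

/-! ### Subgroups of order 2 in F₃₆ and their cosets -/

section F36

variable {G : Type*} [Group G] (e : G ≃* F36) {G' : Subgroup G}

/-- The generator has linear part ±1, and it is not a translation because C₃ × C₃ has odd order. -/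
lemma exists_involution_of_card_eq_two (hG' : Nat.card G' = 2) :
    ∃ v, ∀ γ, γ ∈ G' ↔ e γ = 1 ∨ e γ = involution v := by
  have hfin : Finite G' := Nat.finite_of_card_ne_zero (by omega)
  obtain ⟨s, hs, huniv⟩ := (Nat.card_eq_two_iff' (1 : G')).1 hG'
  have hmem : ∀ γ, γ ∈ G' ↔ γ = 1 ∨ γ = s := by
    intro γ
    constructor
    · intro h
      by_cases h1 : γ = 1
      · exact Or.inl h1
      · exact Or.inr (congrArg Subtype.val
          (huniv ⟨γ, h⟩ fun h2 => h1 (congrArg Subtype.val h2)))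
    · rintro (rfl | rfl)
      · exact one_mem _
      · exact s.2
  have hsq : (s : G) ^ 2 = 1 := by
    rw [← Subgroup.coe_pow, ← hG', pow_card_eq_one', Subgroup.coe_one]
  have hr : (e s).right.1 ^ 2 = 1 := by
    have h1 : (e s).right ^ 2 = 1 := by
      rw [← SemidirectProduct.rightHom_eq_right, ← map_pow, ← map_pow, hsq, map_one, map_one]
    rw [← Subgroup.coe_pow, h1, Subgroup.coe_one]
  refine ⟨(e s).left, fun γ => ?_⟩
  rw [hmem, EmbeddingLike.map_eq_one_iff]
  rcases eq_of_right_sq_eq_one hr with h | h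
  · exfalso
    have h2 : (e s) ^ 2 = 1 := by rw [← map_pow, hsq, map_one]
    have h3 : ∀ v : C3xC3, v ^ 2 = 1 → v = 1 := by decide
    rw [h, ← map_pow, ← map_one (SemidirectProduct.inl),
      SemidirectProduct.inl_injective.eq_iff] at h2
    rw [h3 _ h2, map_one, EmbeddingLike.map_eq_one_iff] at h
    exact hs (Subtype.ext h)
  · rw [← h, e.injective.eq_iff]

include e in
/-- In a group isomorphic to `F₃₆`, every subgroup of order 2 is the fibre over `1` of a surjective
crossed homomorphism to `SmallGroup(18,4)`. -/
theorem exists_isCrossedParam_of_card_eq_two (hG' : Nat.card G' = 2) :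
    ∃ (θ : G →* MulAut SmallGroup18_4) (f : G → SmallGroup18_4), IsCrossedParam G' θ f := by
  obtain ⟨v, hv⟩ := exists_involution_of_card_eq_two e hG'
  refine ⟨holomorphAction.comp e.toMonoidHom, fun γ => (crossedMap v⁻¹ (e γ))⁻¹, ?_, ?_, ?_⟩
  · intro n
    obtain ⟨δ, hδ⟩ := crossedMap_surjective v⁻¹ n⁻¹
    exact ⟨e.symm δ, by simp [hδ]⟩
  · intro γ δ
    rw [map_mul, crossedMap_mul, mul_inv_rev, ← map_inv]
    rfl
  · intro γ
    rw [inv_eq_one, crossedMap_eq_one_iff, hv]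

/-- With q the quarter turn, (w, q)² = (w + qw, -1), and 1 + q is invertible because (1 + q)(1 - q)
= 2. -/
lemma involution_eq_sq (v : C3xC3) : ∃ g : F36, g ^ 2 = involution v := by
  have h : ∀ v : C3xC3, ∃ w, w * quarterTurn w = v := by decide
  obtain ⟨w, hw⟩ := h v
  refine ⟨⟨w, ⟨quarterTurn, Subgroup.mem_zpowers _⟩⟩, ?_⟩
  rw [sq]
  exact SemidirectProduct.ext hw (Subtype.ext ((sq _).symm.trans quarterTurn_sq))

/-- Conjugating by a translation t changes the translation part to v - 2t, which differs from v when
t is nonzero. -/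
lemma exists_conj_involution_ne (v : C3xC3) : ∃ g : F36, g⁻¹ * involution v * g ≠ involution v := by
  refine ⟨SemidirectProduct.inl (Multiplicative.ofAdd (1, 0)), fun h => ?_⟩
  have h1 := congrArg SemidirectProduct.left h
  change (Multiplicative.ofAdd (1, 0))⁻¹ * v * inversion (Multiplicative.ofAdd (1, 0)) = v at h1
  clear h
  revert h1
  revert v
  decide

include e in
/-- In a group isomorphic to `F₃₆`, no regular group of permutations of the cosets of a subgroup of
order 2 consists of left translations. -/
theorem not_le_range_of_card_eq_two (hG' : Nat.card G' = 2) {M : Subgroup (Equiv.Perm (G ⧸ G'))}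
    (hM : IsRegularSubgroup M) (hle : M ≤ (MulAction.toPermHom G (G ⧸ G')).range) : False := by
  have hcardG : Nat.card G = 36 := (Nat.card_congr e.toEquiv).trans card_F36
  have hfinG : Finite G := Nat.finite_of_card_ne_zero (by omega)
  obtain ⟨v, hv⟩ := exists_involution_of_card_eq_two e hG'
  have hcardM : Nat.card M = 18 := by
    have h1 : Nat.card M = Nat.card (G ⧸ G') := by
      refine Nat.card_congr (Equiv.ofBijective (fun m => m.1 ((1 : G) : G ⧸ G')) ⟨?_, ?_⟩)
      · intro m n h
        exact Subtype.ext ((hM (1 : G) _).unique ⟨m.2, rfl⟩ ⟨n.2, h.symm⟩)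
      · intro x
        obtain ⟨n, hn, -⟩ := hM (1 : G) x
        exact ⟨⟨n, hn.1⟩, hn.2⟩
    have h2 := G'.index_mul_card
    rw [hG', hcardG] at h2
    rw [h1, ← Subgroup.index_eq_card]
    omega
  let P : Subgroup G := M.comap (MulAction.toPermHom G (G ⧸ G'))
  have hP : 18 ≤ Nat.card P := by
    rw [← hcardM]
    refine Nat.card_le_card_of_surjective
      (fun p : P => (⟨MulAction.toPermHom G (G ⧸ G') p, p.2⟩ : M)) ?_
    rintro ⟨m, hm⟩
    obtain ⟨g, rfl⟩ := hle hm
    exact ⟨⟨g, hm⟩, rfl⟩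
  have hindex : P.index = 1 ∨ P.index = 2 := by
    have h := P.index_mul_card
    rw [hcardG] at h
    have h0 : P.index ≠ 0 := Subgroup.index_ne_zero_of_finite
    have h3 : P.index ≤ 2 := by nlinarith
    omega
  have hsq : ∀ g, g ^ 2 ∈ P := by
    intro g
    rcases hindex with h | h
    · rw [Subgroup.index_eq_one.1 h]
      exact Subgroup.mem_top _
    · exact Subgroup.sq_mem_of_index_two h g
  -- The generator of `G'` is a square, so its translation lies in `M`. It fixes the base coset, and
  -- regularity then makes it the identity.
  obtain ⟨g, hg⟩ := involution_eq_sq v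
  let s : G := (e.symm g) ^ 2
  have hes : e s = involution v := by rw [map_pow, e.apply_symm_apply, hg]
  have hs : s ∈ G' := (hv s).2 (Or.inr hes)
  have htriv : MulAction.toPermHom G (G ⧸ G') s = 1 := by
    refine (hM (1 : G) (1 : G)).unique ⟨hsq _, ?_⟩ ⟨one_mem _, rfl⟩
    change ((s * 1 : G) : G ⧸ G') = ((1 : G) : G ⧸ G')
    rw [mul_one, eq_comm, QuotientGroup.eq]
    simpa using hs
  -- Acting trivially would put every conjugate of `s` into `G'`; the conjugate by `c` is neither 1
  -- nor the reflection.
  obtain ⟨c, hc⟩ := exists_conj_involution_ne v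
  have h1 : ((s * e.symm c : G) : G ⧸ G') = (e.symm c : G) :=
    congrArg (fun π : Equiv.Perm (G ⧸ G') => π (e.symm c : G)) htriv
  rw [eq_comm, QuotientGroup.eq, hv, map_mul, map_mul, map_inv, e.apply_symm_apply, hes,
    ← mul_assoc] at h1
  rcases h1 with h1 | h1
  · have h2 : involution v = 1 := by
      have h3 := congrArg (fun x => c * x * c⁻¹) h1
      simpa [mul_assoc] using h3
    exact hc (by rw [h2]; simp)
  · exact hc h1

end F36

/-! ### Galois theory of the normal closure -/

/-- The normal closure of a finite separable extension is a finite Galois extension. -/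
lemma isGalois_of_isNormalClosure {k K L : Type*} [Field k] [Field K] [Field L] [Algebra k K]
    [Algebra k L] [FiniteDimensional k K] [Algebra.IsSeparable k K]
    (h : IsNormalClosure k K L) : FiniteDimensional k L ∧ IsGalois k L := by
  have hn : Normal k L := h.normal
  have htop := (Algebra.IsAlgebraic.isNormalClosure_iff.1 h).2
  have hfin : FiniteDimensional k (IntermediateField.normalClosure k K L) := inferInstance
  have hsep : Algebra.IsSeparable k (IntermediateField.normalClosure k K L) := by
    -- The normal closure is the compositum of the images of `K`, each of which is separable over
    -- `k`.
    have : ∀ f : K →ₐ[k] L, Algebra.IsSeparable k f.fieldRange := fun f =>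
      Algebra.IsSeparable.of_algHom k K (AlgEquiv.ofInjectiveField f).symm.toAlgHom
    exact IntermediateField.isSeparable_iSup k L
  rw [htop] at hfin hsep
  have hsep' : Algebra.IsSeparable k L :=
    Algebra.IsSeparable.of_algHom k _ (IntermediateField.topEquiv (F := k) (E := L)).symm.toAlgHom
  exact ⟨Module.Finite.equiv (IntermediateField.topEquiv (F := k) (E := L)).toLinearEquiv, ⟨⟩⟩

lemma card_fixingSubgroup_mul_finrank {k L : Type*} [Field k] [Field L] [Algebra k L]
    [FiniteDimensional k L] [IsGalois k L] (F : IntermediateField k L) :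
    Nat.card F.fixingSubgroup * Module.finrank k F = Nat.card (L ≃ₐ[k] L) := by
  rw [IntermediateField.finrank_eq_fixingSubgroup_index, Subgroup.card_mul_index]

end HopfGalois

theorem mainTheorem8
    {k : Type u} {L : Type v} [Field k] [Field L] [Algebra k L]
    (K F : IntermediateField k L)
    (hsep : Algebra.IsSeparable k K)
    (hdeg : Module.finrank k K = 6)
    (hclosure : IsNormalClosure k K L)
    (hGal : Nonempty ((L ≃ₐ[k] L) ≃* HopfGalois.F36))
    (hKF : K ≤ F) :
    (Module.finrank k F = 12 → ¬ HopfGalois.IsHopfGalois k F) ∧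
    (Module.finrank k F = 18 →
      HopfGalois.IsHopfGalois k F ∧
      HopfGalois.HasHopfGaloisStructureOfType k F L HopfGalois.SmallGroup18_4 ∧
      ¬ HopfGalois.IsAlmostClassicallyGalois F) := by
  have hfinK : FiniteDimensional k K := Module.finite_of_finrank_pos (by omega)
  obtain ⟨hfinL, hgalL⟩ := HopfGalois.isGalois_of_isNormalClosure hclosure
  obtain ⟨e⟩ := hGal
  have hcard := HopfGalois.card_fixingSubgroup_mul_finrank F
  rw [Nat.card_congr e.toEquiv, HopfGalois.card_F36] at hcard
  constructor
  · intro h12 hHG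
    obtain ⟨N, _, θ, f, hf⟩ := HopfGalois.exists_isCrossedParam_of_isHopfGalois hHG
    exact HopfGalois.not_isCrossedParam_of_card_eq_three e (by rw [h12] at hcard; omega) hf
  · intro h18
    have hG' : Nat.card F.fixingSubgroup = 2 := by rw [h18] at hcard; omega
    obtain ⟨θ, f, hf⟩ := HopfGalois.exists_isCrossedParam_of_card_eq_two e hG'
    have hN := hf.hasHopfGaloisStructureOfType
    refine ⟨?_, hN, ?_⟩
    · obtain ⟨hfin, H, i1, i2, μ, hμ, -⟩ := hN
      exact ⟨hfin, H, i1, i2, μ, hμ⟩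
    · rintro ⟨M, hM, -, hle⟩
      exact HopfGalois.not_le_range_of_card_eq_two e hG' hM hle
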